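/- For an integer $k\ge 3$ and $i\in\{1,\dots,k\}$ let $C_i\subset\mathbb R^2$ be the cone of all $v\ne 0$ whose counterclockwise angle from the direction $(1,0)$ lies in $[2\pi(i-1)/k,\,2\pi i/k)$. In the $\theta_k$-graph of a point set $S\subset\mathbb R^2$, each vertex $u\in S$ chooses, for each $i$, a point $w\in S\cap(u+C_i)$ (if there is one) whose orthogonal projection on the axis (bisector) of $u+C_i$ is closest to $u$; this creates the edge $uw$. The edge $uw$ created by $u$ is called mutual if $w$ also chooses $u$, in one of the cones of $w$. Let $S$ be a homogeneous Poisson point process of unit intensity in $\mathbb R^2$, and let $p_k$ denote the probability that an edge of its $\theta_k$-graph is mutual, that is, for a Borel set $W\subset\mathbb R^2$ of positive finite area and $i\in\{1,\dots,k\}$, $$p_k=\frac{\mathbb E\,\#\{\text{mutual edges created by vertices } u\in S\cap W \text{ in their } i\text{th cones}\}}{\mathbb E\,\#\{\text{edges created by vertices } u\in S\cap W \text{ in their } i\text{th cones}\}} .$$ Lemma. For every odd $k\ge 5$ and every choice of $W$ and $i$ as above, $$p_k=\frac{2\beta\cot\left(\frac{\pi}{k}\right)}{\gamma\alpha}\left(\arctan\left(\frac{2\left(\cos\frac{\pi}{k}+\cos\frac{3\pi}{k}\right)^2}{\alpha\beta}\right)+\arctan\left(\frac{4\left(2\cos\frac{2\pi}{k}+\left(\sin\frac{2\pi}{k}\right)^2\right)}{\alpha\beta}\right)\right),$$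 where $$\gamma=4+11\cos\tfrac{2\pi}{k}+\cos\tfrac{6\pi}{k},$$ $$\alpha=\sqrt{\frac{\left(27\cos\frac{\pi}{k}+17\cos\frac{3\pi}{k}+3\cos\frac{5\pi}{k}+\cos\frac{7\pi}{k}\right)\csc\frac{\pi}{k}}{\gamma}},$$ $$\beta=\sqrt{18\sin\tfrac{2\pi}{k}+18\sin\tfrac{4\pi}{k}+11\sin\tfrac{6\pi}{k}+\sin\tfrac{8\pi}{k}+\sin\tfrac{10\pi}{k}} .$$ In particular the value does not depend on $W$ or $i$. -/

import Mathlib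

open MeasureTheory ProbabilityTheory Set
open scoped ENNReal

noncomputable section

namespace ThetaGraph

/-- The cone `C_i` with apex at the origin, for the `k` cones indexed from `0`: all points whose
counterclockwise angle from the positive horizontal axis lies in `[2πi/k, 2π(i+1)/k)`. The apex,
at which the angle is undefined, is left out. -/
def cone (k : ℕ) (i : Fin k) : Set (ℝ × ℝ) :=
  {v | ∃ ρ : ℝ, 0 < ρ ∧
    ∃ φ ∈ Ico (2 * Real.pi * (i : ℕ) / k) (2 * Real.pi * ((i : ℕ) + 1) / k),
      v = (ρ * Real.cos φ, ρ * Real.sin φ)}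

/-- The direction angle of the axis (bisector) of `C_i`. -/
def axisAngle (k : ℕ) (i : Fin k) : ℝ :=
  2 * Real.pi * (i : ℕ) / k + Real.pi / k

/-- The signed distance from the origin to the orthogonal projection of `v` onto the axis of
`C_i`. -/
def height (k : ℕ) (i : Fin k) (v : ℝ × ℝ) : ℝ :=
  v.1 * Real.cos (axisAngle k i) + v.2 * Real.sin (axisAngle k i)

/-- In the `θ_k`-graph of `S`, the vertex `u` chooses `w` as its neighbour in the `i`-th cone:
`w` is the point of `S` in `C_i + u` whose orthogonal projection on the axis of `C_i + u` is
closest to `u`. -/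
def Chooses (k : ℕ) (S : Set (ℝ × ℝ)) (i : Fin k) (u w : ℝ × ℝ) : Prop :=
  u ∈ S ∧ w ∈ S ∧ w - u ∈ cone k i ∧
    ∀ v ∈ S, v - u ∈ cone k i → height k i (w - u) ≤ height k i (v - u)

/-- The edges `uw` of the `θ_k`-graph of `S` that are created by a vertex `u ∈ W` in its `i`-th
cone, as pairs `(u, w)`. -/
def edges (k : ℕ) (S W : Set (ℝ × ℝ)) (i : Fin k) : Set ((ℝ × ℝ) × (ℝ × ℝ)) :=
  {e | e.1 ∈ W ∧ Chooses k S i e.1 e.2}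

/-- Those edges that are mutual, that is, created by `u` (in its `i`-th cone) and also by `w` (in
one of its cones). -/
def mutualEdges (k : ℕ) (S W : Set (ℝ × ℝ)) (i : Fin k) : Set ((ℝ × ℝ) × (ℝ × ℝ)) :=
  {e | e ∈ edges k S W i ∧ ∃ j : Fin k, Chooses k S j e.2 e.1}

/-- `N` is a homogeneous Poisson point process of unit intensity on the plane: a random locally
finite set of points such that the number of points in a Borel set of finite area `A` has the
Poisson distribution with parameter `A`, and the numbers of points in finitely many disjoint Borel
sets are independent. -/
structure IsUnitPoissonProcess {Ω : Type*} [MeasurableSpace Ω] (P : Measure Ω)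
    (N : Ω → Set (ℝ × ℝ)) : Prop where
  locallyFinite : ∀ (ω : Ω) (B : Set (ℝ × ℝ)), Bornology.IsBounded B → (N ω ∩ B).Finite
  measurable_count : ∀ B : Set (ℝ × ℝ), MeasurableSet B →
    Measurable fun ω => (N ω ∩ B).encard
  law_count : ∀ B : Set (ℝ × ℝ), MeasurableSet B → volume B ≠ ∞ → ∀ n : ℕ,
    P {ω | (N ω ∩ B).encard = n} = poissonMeasure (volume B).toNNReal {n}
  indep_count : ∀ (m : ℕ) (B : Fin m → Set (ℝ × ℝ)), (∀ j, MeasurableSet (B j)) →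
    Pairwise (fun j j' => Disjoint (B j) (B j')) →
    iIndepFun (fun j ω => (N ω ∩ B j).encard) P

/-- The probability that an edge of the `θ_k`-graph of the random set `N` is mutual, for a typical
edge that a vertex in the window `W` creates in its `i`-th cone: the expected number of mutual
edges of this kind divided by the expected number of all edges of this kind. -/
def mutualEdgeProb {Ω : Type*} [MeasurableSpace Ω] (P : Measure Ω) (N : Ω → Set (ℝ × ℝ))
    (k : ℕ) (W : Set (ℝ × ℝ)) (i : Fin k) : ℝ :=
  ((∫⁻ ω, ((mutualEdges k (N ω) W i).encard : ℝ≥0∞) ∂P) /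
    (∫⁻ ω, ((edges k (N ω) W i).encard : ℝ≥0∞) ∂P)).toReal

/-- The quantity `γ`. -/
def oddGamma (k : ℕ) : ℝ :=
  4 + 11 * Real.cos (2 * Real.pi / k) + Real.cos (6 * Real.pi / k)

/-- The quantity `α`. -/
def oddAlpha (k : ℕ) : ℝ :=
  √((27 * Real.cos (Real.pi / k) + 17 * Real.cos (3 * Real.pi / k)
      + 3 * Real.cos (5 * Real.pi / k) + Real.cos (7 * Real.pi / k))
    * (1 / Real.sin (Real.pi / k)) / oddGamma k)

/-- The quantity `β`. -/
def oddBeta (k : ℕ) : ℝ :=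
  √(18 * Real.sin (2 * Real.pi / k) + 18 * Real.sin (4 * Real.pi / k)
    + 11 * Real.sin (6 * Real.pi / k) + Real.sin (8 * Real.pi / k)
    + Real.sin (10 * Real.pi / k))

end ThetaGraph

end

/-!
A pair `(u, w)` of points of the process `S` is an edge created by `u` in its `i`-th cone when
`w - u ∈ C_i` and `S` has no point in a certain triangle `u + T(w - u)`. It is a mutual edge when
`S` has no point in the union of this triangle and the one in which `w` would prefer a point to
`u`. So both expectations are expected numbers of pairs with an empty neighbourhood.

These come from the Mecke formula: for points `u` of a Poisson process, the expected sum of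
`F (S, u)` is the integral over `u` of the expectation of `F (S ∪ {u}, u)`
(`IsUnitPoissonProcess.lintegral_countKernel_eq`). Both sides are integrals with respect to
measures on pairs (configuration, point), and these agree on products of a void event `S ∩ B = ∅`
and a Borel set `A`, where the formula says that the numbers of points in `A \ B` and in `B` are
independent. The void events are closed under intersection and, as the configurations are locally
finite, generate the counts of points (`measurable_encard`). Applied twice, the formula gives
`area W * ∫ v in C, exp (-area (G v))` for the expected number of pairs with `w - u ∈ C` and an
empty region `u + G (w - u)` (`IsUnitPoissonProcess.lintegral_encard_pairs`).

For odd `k` the cone `-C_i` is divided by its axis into halves of two cones. Let `θ = π / k`. In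
coordinates along and across the axis of `C_i`, reflected such that the edge has end point
`(h, y)` with `0 ≤ y`, the second triangle has its apex at `(h, y)` and axis direction `π + θ`.
What it leaves of the first triangle is two triangles, one above and one below it; adding three
triangle areas gives the area of the union as a quadratic form in `(h, y)` (`unionArea`,
`volume_mutualRegion`). Integrating `exp (-area)` along each ray leaves `∫ dt / q(t)` over slopes
`0 ≤ t ≤ tan θ` with a quadratic polynomial `q` (`mutualEdgeProb_eq_integral`), while for all
edges the integral over the cone is `1`. The integral of `1 / q` is a sum of two arctangents
(`integral_one_div_unionArea`), and trigonometric identities for the multiples of `θ` bring it to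
the form with `α`, `β` and `γ`.
-/

noncomputable section

namespace ThetaGraph

/-! ### Locally finite configurations and their counting measures -/

/-- A locally finite set of points of the plane. -/
structure Config where
  /-- The points of the configuration. -/
  points : Set (ℝ × ℝ)
  finite_inter : ∀ B : Set (ℝ × ℝ), Bornology.IsBounded B → (points ∩ B).Finite

/-- The events that a Borel set `B` contains no point of the configuration. -/
def voidEvents : Set (Set Config) :=
  {V | ∃ B : Set (ℝ × ℝ), MeasurableSet B ∧ V = {S | S.points ∩ B = ∅}}

/-- The σ-algebra on configurations is the one generated by the void events, which form a
π-system. By `measurable_encard` it makes the numbers of points in Borel sets measurable. -/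
instance : MeasurableSpace Config := MeasurableSpace.generateFrom voidEvents

lemma isPiSystem_voidEvents : IsPiSystem voidEvents := by
  rintro _ ⟨B, hB, rfl⟩ _ ⟨B', hB', rfl⟩ -
  refine ⟨B ∪ B', hB.union hB', ?_⟩
  ext S
  simp [inter_union_distrib_left]

lemma measurableSet_void {B : Set (ℝ × ℝ)} (hB : MeasurableSet B) :
    MeasurableSet {S : Config | S.points ∩ B = ∅} :=
  MeasurableSpace.measurableSet_generateFrom ⟨B, hB, rfl⟩

/-- A configuration has at least `m + 1` points in `B` if and only if a basic open set `U` meets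
`B` in a point of it and there are `m` further points in `B \ U`: the points are isolated. -/
lemma natCast_succ_le_encard_iff (S : Config) (B : Set (ℝ × ℝ)) (m : ℕ) :
    ((m + 1 : ℕ) : ℕ∞) ≤ (S.points ∩ B).encard ↔
      ∃ U ∈ TopologicalSpace.countableBasis (ℝ × ℝ),
        S.points ∩ (B ∩ U) ≠ ∅ ∧ (m : ℕ∞) ≤ (S.points ∩ (B \ U)).encard := by
  constructor
  · intro h
    have hne : (S.points ∩ B).Nonempty := by
      rw [← encard_pos]
      exact lt_of_lt_of_le (by positivity) h
    obtain ⟨x, hxS, hxB⟩ := hne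
    -- Any basic neighbourhood of `x` that avoids the other points near `x` serves as `U`.
    have hfin : ((S.points ∩ Metric.ball x 1) \ {x}).Finite :=
      (S.finite_inter _ Metric.isBounded_ball).subset sdiff_subset
    have hopen : IsOpen (Metric.ball x 1 ∩ ((S.points ∩ Metric.ball x 1) \ {x})ᶜ) :=
      Metric.isOpen_ball.inter hfin.isClosed.isOpen_compl
    obtain ⟨U, hU, hxU, hUsub⟩ :=
      (TopologicalSpace.isBasis_countableBasis (ℝ × ℝ)).exists_subset_of_mem_open
        (⟨Metric.mem_ball_self one_pos, fun hx => hx.2 rfl⟩ : x ∈ Metric.ball x 1 ∩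
          ((S.points ∩ Metric.ball x 1) \ {x})ᶜ) hopen
    refine ⟨U, hU, nonempty_iff_ne_empty.1 ⟨x, hxS, hxB, hxU⟩, ?_⟩
    have hsub : S.points ∩ B ⊆ insert x (S.points ∩ (B \ U)) := by
      rintro y ⟨hyS, hyB⟩
      by_cases hyU : y ∈ U
      · left
        by_contra hyx
        exact (hUsub hyU).2 ⟨⟨hyS, (hUsub hyU).1⟩, hyx⟩
      · exact Or.inr ⟨hyS, hyB, hyU⟩
    have h1 := (h.trans (encard_le_encard hsub)).trans (encard_insert_le _ _)
    push_cast at h1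
    exact (ENat.add_le_add_iff_right (by simp)).1 h1
  · rintro ⟨U, -, hne, hm⟩
    have hdisj : Disjoint (S.points ∩ (B ∩ U)) (S.points ∩ (B \ U)) :=
      disjoint_left.2 fun x hx hx' => hx'.2.2 hx.2.2
    have hunion : S.points ∩ B = S.points ∩ (B ∩ U) ∪ S.points ∩ (B \ U) := by
      rw [← inter_union_distrib_left, inter_union_sdiff]
    rw [hunion, encard_union_eq hdisj, Nat.add_comm m 1]
    push_cast
    exact add_le_add (one_le_encard_iff_nonempty.2 (nonempty_iff_ne_empty.2 hne)) hm

lemma measurableSet_natCast_le_encard (m : ℕ) {B : Set (ℝ × ℝ)} (hB : MeasurableSet B) :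
    MeasurableSet {S : Config | (m : ℕ∞) ≤ (S.points ∩ B).encard} := by
  induction m generalizing B with
  | zero => simp
  | succ m ih =>
    have h : {S : Config | ((m + 1 : ℕ) : ℕ∞) ≤ (S.points ∩ B).encard} =
        ⋃ U ∈ TopologicalSpace.countableBasis (ℝ × ℝ), {S : Config | S.points ∩ (B ∩ U) = ∅}ᶜ ∩
          {S : Config | (m : ℕ∞) ≤ (S.points ∩ (B \ U)).encard} := by
      ext S
      rw [mem_ofPred_eq, natCast_succ_le_encard_iff]
      simp only [mem_iUnion, mem_inter_iff, mem_compl_iff, mem_ofPred_eq, exists_prop, ne_eq]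
    rw [h]
    refine MeasurableSet.biUnion (TopologicalSpace.countable_countableBasis _) fun U hU => ?_
    have hUm : MeasurableSet U := (TopologicalSpace.isOpen_of_mem_countableBasis hU).measurableSet
    exact (measurableSet_void (hB.inter hUm)).compl.inter (ih (hB.diff hUm))

lemma measurable_encard {B : Set (ℝ × ℝ)} (hB : MeasurableSet B) :
    Measurable fun S : Config => (S.points ∩ B).encard := by
  have hnat : ∀ m : ℕ, MeasurableSet {S : Config | (S.points ∩ B).encard = m} := by
    intro m
    have h : {S : Config | (S.points ∩ B).encard = m} =
        {S : Config | (m : ℕ∞) ≤ (S.points ∩ B).encard} \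
          {S : Config | ((m + 1 : ℕ) : ℕ∞) ≤ (S.points ∩ B).encard} := by
      ext S
      simp only [mem_ofPred_eq, mem_sdiff, not_le]
      push_cast
      rw [ENat.lt_add_one_iff (by simp)]
      exact ⟨fun h => ⟨h.ge, h.le⟩, fun h => le_antisymm h.2 h.1⟩
    rw [h]
    exact (measurableSet_natCast_le_encard m hB).diff (measurableSet_natCast_le_encard _ hB)
  refine measurable_to_countable' fun n => ?_
  induction n using ENat.recTopCoe with
  | coe m => exact hnat m
  | top =>
    have h : (fun S : Config => (S.points ∩ B).encard) ⁻¹' {⊤} =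
        ⋂ m : ℕ, {S : Config | (S.points ∩ B).encard = m}ᶜ := by
      ext S
      simp only [mem_preimage, mem_singleton_iff, mem_iInter, mem_compl_iff, mem_ofPred_eq]
      constructor
      · intro h m
        rw [h]
        exact ENat.top_ne_natCast m
      · intro h
        by_contra hne
        obtain ⟨m, hm⟩ := ENat.ne_top_iff_exists.1 hne
        exact h m hm.symm
    rw [h]
    exact MeasurableSet.iInter fun m => (hnat m).compl

lemma Config.countable (S : Config) : S.points.Countable := by
  have h : S.points = ⋃ n : ℕ, S.points ∩ Metric.closedBall 0 n := by
    rw [← inter_iUnion, Metric.iUnion_closedBall_nat, inter_univ]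
  rw [h]
  exact countable_iUnion fun n => (S.finite_inter _ Metric.isBounded_closedBall).countable

lemma count_restrict_apply (S : Config) {B : Set (ℝ × ℝ)} (hB : MeasurableSet B) :
    (Measure.count.restrict S.points : Measure (ℝ × ℝ)) B = (S.points ∩ B).encard := by
  rw [Measure.restrict_apply hB, Measure.count_apply (hB.inter S.countable.measurableSet),
    inter_comm]

/-- The counting measure of a configuration, as a kernel. -/
def countKernel : Kernel Config (ℝ × ℝ) where
  toFun S := Measure.count.restrict S.points
  measurable' := by
    refine Measure.measurable_of_measurable_coe _ fun B hB => ?_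
    simp_rw [count_restrict_apply _ hB]
    exact Measurable.comp (Measurable.of_discrete (f := fun n : ℕ∞ => (n : ℝ≥0∞)))
      (measurable_encard hB)

lemma countKernel_apply (S : Config) {B : Set (ℝ × ℝ)} (hB : MeasurableSet B) :
    countKernel S B = (S.points ∩ B).encard :=
  count_restrict_apply S hB

lemma lintegral_countKernel (S : Config) (f : ℝ × ℝ → ℝ≥0∞) :
    ∫⁻ x, f x ∂countKernel S = ∑' x : S.points, f x := by
  change ∫⁻ x in S.points, f x ∂Measure.count = _
  rw [lintegral_countable _ S.countable]
  simp

/-- The half-open annuli between consecutive integer radii: bounded sets that partition the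
plane. -/
def annulus (n : ℕ) : Set (ℝ × ℝ) := disjointed (fun n : ℕ => Metric.closedBall 0 (n : ℝ)) n

lemma measurableSet_annulus (n : ℕ) : MeasurableSet (annulus n) :=
  MeasurableSet.disjointed (fun _ => Metric.isClosed_closedBall.measurableSet) n

lemma isBounded_annulus (n : ℕ) : Bornology.IsBounded (annulus n) :=
  Metric.isBounded_closedBall.subset (disjointed_subset _ n)

lemma iUnion_annulus : ⋃ n, annulus n = univ := by
  simp_rw [annulus]
  rw [iUnion_disjointed, Metric.iUnion_closedBall_nat]

lemma pairwise_disjoint_annulus : Pairwise (Function.onFun Disjoint annulus) :=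
  disjoint_disjointed _

/-- The counting kernel is a countable sum of uniformly bounded kernels: cut the plane into annuli
and distinguish the number of points in each. -/
instance : IsSFiniteKernel countKernel := by
  classical
  have hms : ∀ p : ℕ × ℕ, MeasurableSet
      {S : Config | (S.points ∩ annulus p.1).encard = (p.2 : ℕ∞)} := fun p =>
    measurable_encard (measurableSet_annulus p.1) (MeasurableSet.of_discrete (s := {(p.2 : ℕ∞)}))
  let κ : ℕ × ℕ → Kernel Config (ℝ × ℝ) := fun p =>
    Kernel.piecewise (hms p) (countKernel.restrict (measurableSet_annulus p.1)) 0
  have hκ : ∀ p, IsFiniteKernel (κ p) := by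
    intro p
    refine ⟨⟨(p.2 : ℝ≥0∞), ENNReal.natCast_lt_top _, fun S => ?_⟩⟩
    by_cases hS : S ∈ {S : Config | (S.points ∩ annulus p.1).encard = (p.2 : ℕ∞)}
    · simp only [κ, Kernel.piecewise_apply, if_pos hS]
      rw [Kernel.restrict_apply' _ _ _ MeasurableSet.univ, univ_inter,
        countKernel_apply S (measurableSet_annulus p.1), hS]
      simp
    · simp only [κ, Kernel.piecewise_apply, if_neg hS]
      simp
  have hsum : countKernel = Kernel.sum κ := by
    ext S B hB
    rw [Kernel.sum_apply' _ _ hB, ENNReal.summable.tsum_prod' fun _ => ENNReal.summable]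
    have h1 : ∀ n, ∑' m, κ (n, m) S B = countKernel S (B ∩ annulus n) := by
      intro n
      obtain ⟨m, hm⟩ := ENat.ne_top_iff_exists.1
        (encard_ne_top_iff.2 (S.finite_inter _ (isBounded_annulus n)))
      rw [tsum_eq_single m]
      · have hS : S ∈ {S : Config | (S.points ∩ annulus (n, m).1).encard = ((n, m).2 : ℕ∞)} :=
          hm.symm
        simp only [κ, Kernel.piecewise_apply, if_pos hS]
        rw [Kernel.restrict_apply' _ _ _ hB]
      · intro m' hm'
        have hS : S ∉ {S : Config | (S.points ∩ annulus (n, m').1).encard = ((n, m').2 : ℕ∞)} := by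
          intro h
          exact hm' (by exact_mod_cast h.symm.trans hm.symm)
        simp only [κ, Kernel.piecewise_apply, if_neg hS]
        simp
    simp_rw [h1]
    rw [← measure_iUnion (fun i j hij => (pairwise_disjoint_annulus hij).mono inter_subset_right
      inter_subset_right) (fun n => hB.inter (measurableSet_annulus n)), ← inter_iUnion,
      iUnion_annulus, inter_univ]
  rw [hsum]
  infer_instance

/-- The configuration with one more point. -/
def Config.insert (u : ℝ × ℝ) (S : Config) : Config where
  points := Insert.insert u S.points
  finite_inter B hB := ((S.finite_inter B hB).insert u).subset <| by
    rintro x ⟨hx | hx, hxB⟩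
    · exact Or.inl hx
    · exact Or.inr ⟨hx, hxB⟩

lemma Config.insert_points (u : ℝ × ℝ) (S : Config) :
    (S.insert u).points = Insert.insert u S.points := rfl

lemma insert_inter_eq_empty_iff (u : ℝ × ℝ) (s B : Set (ℝ × ℝ)) :
    Insert.insert u s ∩ B = ∅ ↔ u ∉ B ∧ s ∩ B = ∅ := by
  constructor
  · intro h
    exact ⟨fun hu => (h ▸ (⟨Or.inl rfl, hu⟩ : u ∈ Insert.insert u s ∩ B) : u ∈ (∅ : Set _)),
      subset_empty_iff.1 (h ▸ inter_subset_inter_left _ (subset_insert _ _))⟩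
  · rintro ⟨hu, h⟩
    rw [insert_inter_of_notMem hu, h]

lemma measurable_config_of_void {α : Type*} [MeasurableSpace α] {f : α → Config}
    (hf : ∀ B, MeasurableSet B → MeasurableSet {a | (f a).points ∩ B = ∅}) : Measurable f :=
  measurable_generateFrom <| by
    rintro _ ⟨B, hB, rfl⟩
    exact hf B hB

lemma measurable_insert : Measurable fun p : Config × (ℝ × ℝ) => p.1.insert p.2 := by
  refine measurable_config_of_void fun B hB => ?_
  simp only [Config.insert_points, insert_inter_eq_empty_iff, ofPred_and]
  exact (measurable_snd hB.compl).inter (measurable_fst (measurableSet_void hB))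

/-! ### The Mecke formula -/

lemma lintegral_natCast_poissonMeasure (r : NNReal) :
    ∫⁻ n, (n : ℝ≥0∞) ∂poissonMeasure r = r := by
  have hone : ∑' n, poissonMeasure r {n} = 1 := by
    have h := lintegral_countable' (μ := poissonMeasure r) (fun _ => (1 : ℝ≥0∞))
    simpa using h.symm
  rw [lintegral_countable', tsum_eq_zero_add' ENNReal.summable]
  have hstep : ∀ n : ℕ, ((n + 1 : ℕ) : ℝ≥0∞) * poissonMeasure r {n + 1} =
      r * poissonMeasure r {n} := by
    intro n
    rw [poissonMeasure_singleton, poissonMeasure_singleton, ← ENNReal.ofReal_natCast,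
      ← ENNReal.ofReal_coe_nnreal, ← ENNReal.ofReal_mul (by positivity),
      ← ENNReal.ofReal_mul (by positivity)]
    congr 1
    rw [Nat.factorial_succ]
    push_cast
    have : ((n : ℝ) + 1) ≠ 0 := by positivity
    field_simp
    ring
  simp_rw [hstep]
  rw [ENNReal.tsum_mul_left, hone]
  simp

section PoissonProcess

variable {Ω : Type*} [MeasurableSpace Ω] {P : Measure Ω} {N : Ω → Set (ℝ × ℝ)}

namespace IsUnitPoissonProcess

lemma map_toNat_encard (hN : IsUnitPoissonProcess P N) {B : Set (ℝ × ℝ)}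
    (hB : MeasurableSet B) (hb : Bornology.IsBounded B) :
    P.map (fun ω => (N ω ∩ B).encard.toNat) = poissonMeasure (volume B).toNNReal := by
  refine Measure.ext_of_singleton fun n => ?_
  have hmeas : Measurable fun ω => (N ω ∩ B).encard.toNat :=
    Measurable.comp (Measurable.of_discrete (f := ENat.toNat)) (hN.measurable_count B hB)
  rw [Measure.map_apply hmeas (MeasurableSet.singleton n),
    ← hN.law_count B hB hb.measure_lt_top.ne n]
  congr 1
  ext ω
  have hfin : (N ω ∩ B).encard ≠ ⊤ := encard_ne_top_iff.2 (hN.locallyFinite ω B hb)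
  rw [mem_preimage, mem_singleton_iff, mem_ofPred_eq, ← ENat.natCast_toNat hfin]
  simp

lemma lintegral_encard_of_isBounded (hN : IsUnitPoissonProcess P N) {B : Set (ℝ × ℝ)}
    (hB : MeasurableSet B) (hb : Bornology.IsBounded B) :
    ∫⁻ ω, ((N ω ∩ B).encard : ℝ≥0∞) ∂P = volume B := by
  have hmeas : Measurable fun ω => (N ω ∩ B).encard.toNat :=
    Measurable.comp (Measurable.of_discrete (f := ENat.toNat)) (hN.measurable_count B hB)
  have h : ∀ ω, ((N ω ∩ B).encard : ℝ≥0∞) = ((N ω ∩ B).encard.toNat : ℝ≥0∞) := by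
    intro ω
    have hfin : (N ω ∩ B).encard ≠ ⊤ := encard_ne_top_iff.2 (hN.locallyFinite ω B hb)
    conv_lhs => rw [← ENat.natCast_toNat hfin]
    simp
  simp_rw [h]
  rw [← lintegral_map (f := fun n : ℕ => (n : ℝ≥0∞)) Measurable.of_discrete hmeas,
    hN.map_toNat_encard hB hb, lintegral_natCast_poissonMeasure,
    ENNReal.coe_toNNReal hb.measure_lt_top.ne]

lemma measure_void (hN : IsUnitPoissonProcess P N) {B : Set (ℝ × ℝ)}
    (hB : MeasurableSet B) (hfin : volume B ≠ ∞) :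
    P {ω | N ω ∩ B = ∅} = ENNReal.ofReal (Real.exp (-(volume B).toReal)) := by
  have h := hN.law_count B hB hfin 0
  rw [poissonMeasure_singleton] at h
  simpa [ENNReal.coe_toNNReal_eq_toReal] using h

/-- The configuration of the points of a Poisson process. -/
def config (hN : IsUnitPoissonProcess P N) (ω : Ω) : Config where
  points := N ω
  finite_inter := hN.locallyFinite ω

lemma config_points (hN : IsUnitPoissonProcess P N) (ω : Ω) : (hN.config ω).points = N ω := rfl

lemma measurable_config (hN : IsUnitPoissonProcess P N) : Measurable hN.config := by
  refine measurable_config_of_void fun B hB => ?_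
  have h : {ω | (hN.config ω).points ∩ B = ∅} = (fun ω => (N ω ∩ B).encard) ⁻¹' {0} := by
    ext ω
    simp [config_points]
  rw [h]
  exact hN.measurable_count B hB (MeasurableSet.singleton 0)

lemma measurable_encard_toENNReal (hN : IsUnitPoissonProcess P N) {B : Set (ℝ × ℝ)}
    (hB : MeasurableSet B) : Measurable fun ω => ((N ω ∩ B).encard : ℝ≥0∞) :=
  Measurable.comp (Measurable.of_discrete (f := fun n : ℕ∞ => (n : ℝ≥0∞)))
    (hN.measurable_count B hB)

lemma lintegral_encard (hN : IsUnitPoissonProcess P N) {B : Set (ℝ × ℝ)}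
    (hB : MeasurableSet B) : ∫⁻ ω, ((N ω ∩ B).encard : ℝ≥0∞) ∂P = volume B := by
  have hm : ∀ n, MeasurableSet (B ∩ annulus n) := fun n => hB.inter (measurableSet_annulus n)
  have hd : Pairwise (Function.onFun Disjoint fun n => B ∩ annulus n) := fun i j hij =>
    (pairwise_disjoint_annulus hij).mono inter_subset_right inter_subset_right
  have hU : ⋃ n, B ∩ annulus n = B := by rw [← inter_iUnion, iUnion_annulus, inter_univ]
  have h : ∀ ω, ((N ω ∩ B).encard : ℝ≥0∞) =
      ∑' n, ((N ω ∩ (B ∩ annulus n)).encard : ℝ≥0∞) := by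
    intro ω
    simp_rw [← hN.config_points ω]
    rw [← countKernel_apply _ hB]
    conv_lhs => rw [← hU]
    rw [measure_iUnion hd hm]
    exact tsum_congr fun n => countKernel_apply _ (hm n)
  simp_rw [h]
  rw [lintegral_tsum fun n => (hN.measurable_encard_toENNReal (hm n)).aemeasurable]
  conv_rhs => rw [← hU, measure_iUnion hd hm]
  exact tsum_congr fun n => hN.lintegral_encard_of_isBounded (hm n)
    ((isBounded_annulus n).subset inter_subset_right)

lemma indepFun_count (hN : IsUnitPoissonProcess P N) {A B : Set (ℝ × ℝ)}
    (hA : MeasurableSet A) (hB : MeasurableSet B) (hAB : Disjoint A B) :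
    IndepFun (fun ω => (N ω ∩ A).encard) (fun ω => (N ω ∩ B).encard) P := by
  have h := hN.indep_count 2 ![A, B] (by intro j; fin_cases j <;> simp [hA, hB]) (by
    intro j j' hjj'
    fin_cases j <;> fin_cases j' <;> simp_all [disjoint_comm])
  exact h.indepFun (i := 0) (j := 1) (by simp)

/-- The Mecke formula for the events `u ∈ A`, `S ∩ B = ∅`: both sides vanish for `u ∈ A ∩ B`, and
on `A \ B` it is the independence of the numbers of points in disjoint sets. -/
lemma setLIntegral_encard_void (hN : IsUnitPoissonProcess P N) {A B : Set (ℝ × ℝ)}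
    (hA : MeasurableSet A) (hB : MeasurableSet B) :
    ∫⁻ ω in {ω | N ω ∩ B = ∅}, ((N ω ∩ A).encard : ℝ≥0∞) ∂P =
      volume (A \ B) * P {ω | N ω ∩ B = ∅} := by
  have hV : MeasurableSet {ω | N ω ∩ B = ∅} := hN.measurable_config (measurableSet_void hB)
  have hind : IndepFun (fun ω => ((N ω ∩ (A \ B)).encard : ℝ≥0∞))
      (fun ω => if (N ω ∩ B).encard = 0 then (1 : ℝ≥0∞) else 0) P :=
    (hN.indepFun_count (hA.diff hB) hB disjoint_sdiff_left).comp
      (φ := fun n : ℕ∞ => (n : ℝ≥0∞)) (ψ := fun n : ℕ∞ => if n = 0 then (1 : ℝ≥0∞) else 0)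
      Measurable.of_discrete Measurable.of_discrete
  have hψ : Measurable fun ω => if (N ω ∩ B).encard = 0 then (1 : ℝ≥0∞) else 0 :=
    Measurable.comp (Measurable.of_discrete (f := fun n : ℕ∞ => if n = 0 then (1 : ℝ≥0∞) else 0))
      (hN.measurable_count B hB)
  have h1 : (fun ω => if (N ω ∩ B).encard = 0 then (1 : ℝ≥0∞) else 0) =
      indicator {ω | N ω ∩ B = ∅} 1 := by
    ext ω
    by_cases h : N ω ∩ B = ∅ <;> simp [h, indicator]
  have h2 := lintegral_mul_eq_lintegral_mul_lintegral_of_indepFun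
    (hN.measurable_encard_toENNReal (hA.diff hB)) hψ hind
  rw [h1, lintegral_indicator_one hV, hN.lintegral_encard (hA.diff hB)] at h2
  rw [← h2, ← lintegral_indicator hV]
  refine lintegral_congr fun ω => ?_
  by_cases h : N ω ∩ B = ∅
  · have hAB : N ω ∩ (A \ B) = N ω ∩ A := by
      rw [← inter_sdiff_assoc, sdiff_eq_left]
      exact disjoint_left.2 fun x hx hxB => (h ▸ (⟨hx.1, hxB⟩ : x ∈ N ω ∩ B) : x ∈ (∅ : Set _))
    simp [h, hAB]
  · simp [h]

/-- The Campbell measure of the Poisson process, written as a law: picking a point `u` of the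
process amounts to adding a point to it at a place distributed like Lebesgue measure. -/
lemma map_config_compProd_countKernel [IsProbabilityMeasure P] (hN : IsUnitPoissonProcess P N) :
    (P.map hN.config) ⊗ₘ countKernel =
      ((P.map hN.config).prod volume).map (fun p => (p.1.insert p.2, p.2)) := by
  have : IsProbabilityMeasure (P.map hN.config) :=
    Measure.isProbabilityMeasure_map hN.measurable_config.aemeasurable
  have hins : Measurable fun p : Config × (ℝ × ℝ) => (p.1.insert p.2, p.2) :=
    measurable_insert.prodMk measurable_snd
  -- The measures are compared on the products of void events and Borel sets, a π-system.
  have hrect : ∀ A B : Set (ℝ × ℝ), MeasurableSet A → MeasurableSet B →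
      ((P.map hN.config) ⊗ₘ countKernel) ({S | S.points ∩ B = ∅} ×ˢ A) =
        volume (A \ B) * P {ω | N ω ∩ B = ∅} := by
    intro A B hA hB
    rw [Measure.compProd_apply_prod (measurableSet_void hB) hA,
      setLIntegral_map (measurableSet_void hB) (countKernel.measurable_coe hA)
        hN.measurable_config, ← hN.setLIntegral_encard_void hA hB]
    exact lintegral_congr fun ω => countKernel_apply _ hA
  refine Measure.ext_of_generateFrom_of_iUnion
    (image2 (· ×ˢ ·) voidEvents {A : Set (ℝ × ℝ) | MeasurableSet A})
    (fun n : ℕ => univ ×ˢ Metric.closedBall 0 (n : ℝ)) ?_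
    (isPiSystem_voidEvents.prod MeasurableSpace.isPiSystem_measurableSet) ?_ ?_ ?_ ?_
  · refine (generateFrom_eq_prod rfl MeasurableSpace.generateFrom_measurableSet ?_
      isCountablySpanning_measurableSet).symm
    exact ⟨fun _ => univ, fun _ => ⟨∅, MeasurableSet.empty, by simp⟩, iUnion_const _⟩
  · rw [← prod_iUnion, Metric.iUnion_closedBall_nat, univ_prod_univ]
  · exact fun n => ⟨univ, ⟨∅, MeasurableSet.empty, by simp⟩, _,
      (Metric.isClosed_closedBall (x := (0 : ℝ × ℝ)) (ε := (n : ℝ))).measurableSet, rfl⟩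
  · intro n
    have h := hrect (Metric.closedBall 0 (n : ℝ)) ∅ Metric.isClosed_closedBall.measurableSet
      MeasurableSet.empty
    simp only [inter_empty, ofPred_true, sdiff_empty, measure_univ, mul_one] at h
    rw [h]
    exact measure_closedBall_lt_top.ne
  · rintro _ ⟨_, ⟨B, hB, rfl⟩, A, hA, rfl⟩
    rw [hrect A B hA hB, Measure.map_apply hins ((measurableSet_void hB).prod hA)]
    have h : (fun p : Config × (ℝ × ℝ) => (p.1.insert p.2, p.2)) ⁻¹'
        ({S | S.points ∩ B = ∅} ×ˢ A) = {S : Config | S.points ∩ B = ∅} ×ˢ (A \ B) := by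
      ext ⟨S, u⟩
      simp only [mem_preimage, mem_prod, mem_ofPred_eq, Config.insert_points,
        insert_inter_eq_empty_iff, mem_sdiff]
      tauto
    rw [h, Measure.prod_prod, Measure.map_apply hN.measurable_config (measurableSet_void hB),
      mul_comm]
    rfl

/-- The Mecke formula: the expected sum of `F (S, u)` over the points `u` of the process `S` is
the integral over the plane of the expectation of `F (S ∪ {u}, u)`. -/
theorem lintegral_countKernel_eq [IsProbabilityMeasure P] (hN : IsUnitPoissonProcess P N)
    {F : Config × (ℝ × ℝ) → ℝ≥0∞} (hF : Measurable F) :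
    ∫⁻ ω, ∫⁻ u, F (hN.config ω, u) ∂countKernel (hN.config ω) ∂P =
      ∫⁻ u, ∫⁻ ω, F ((hN.config ω).insert u, u) ∂P := by
  have : IsProbabilityMeasure (P.map hN.config) :=
    Measure.isProbabilityMeasure_map hN.measurable_config.aemeasurable
  have hins : Measurable fun p : Config × (ℝ × ℝ) => (p.1.insert p.2, p.2) :=
    measurable_insert.prodMk measurable_snd
  have hl : Measurable fun S => ∫⁻ u, F (S, u) ∂countKernel S :=
    Measurable.lintegral_kernel_prod_right' hF
  rw [← lintegral_map hl hN.measurable_config, ← Measure.lintegral_compProd hF,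
    hN.map_config_compProd_countKernel, lintegral_map hF hins,
    lintegral_prod_symm' (fun p : Config × (ℝ × ℝ) => F (p.1.insert p.2, p.2)) (hF.comp hins)]
  refine lintegral_congr fun u => ?_
  exact lintegral_map ((hF.comp hins).comp measurable_prodMk_right) hN.measurable_config

lemma measure_mem_eq_zero (hN : IsUnitPoissonProcess P N) (u : ℝ × ℝ) : P {ω | u ∈ N ω} = 0 := by
  have h := hN.lintegral_encard (MeasurableSet.singleton u)
  rw [measure_singleton, lintegral_eq_zero_iff
    (hN.measurable_encard_toENNReal (MeasurableSet.singleton u))] at h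
  refine measure_mono_null (fun ω hω => ?_) h
  have hω' : u ∈ N ω := hω
  simp [hω']

lemma lintegral_countKernel_insert {S : Config} {u : ℝ × ℝ} (hu : u ∉ S.points)
    (f : ℝ × ℝ → ℝ≥0∞) :
    ∫⁻ w, f w ∂countKernel (S.insert u) = f u + ∫⁻ w, f w ∂countKernel S := by
  change ∫⁻ w in Insert.insert u S.points, f w ∂Measure.count = _
  rw [insert_eq, lintegral_union S.countable.measurableSet (by simpa using hu),
    lintegral_singleton]
  simp
  rfl

/-- The two-point Mecke formula, for functions that vanish on the diagonal. -/
theorem lintegral_countKernel_countKernel_eq [IsProbabilityMeasure P]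
    (hN : IsUnitPoissonProcess P N) {F : (Config × (ℝ × ℝ)) × (ℝ × ℝ) → ℝ≥0∞}
    (hF : Measurable F) (hdiag : ∀ S u, F ((S, u), u) = 0) :
    ∫⁻ ω, ∫⁻ u, ∫⁻ w, F ((hN.config ω, u), w) ∂countKernel (hN.config ω)
        ∂countKernel (hN.config ω) ∂P =
      ∫⁻ u, ∫⁻ w, ∫⁻ ω, F ((((hN.config ω).insert w).insert u, u), w) ∂P := by
  have hG : Measurable fun p : Config × (ℝ × ℝ) => ∫⁻ w, F (p, w) ∂countKernel p.1 := by
    exact Measurable.lintegral_kernel_prod_right'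
      (κ := countKernel.comap Prod.fst measurable_fst) hF
  rw [hN.lintegral_countKernel_eq hG]
  refine lintegral_congr fun u => ?_
  have hins : Measurable fun p : Config × (ℝ × ℝ) => ((p.1.insert u, u), p.2) :=
    ((measurable_insert.comp (measurable_fst.prodMk measurable_const)).prodMk
      measurable_const).prodMk measurable_snd
  have h := hN.lintegral_countKernel_eq (hF.comp hins)
  refine Eq.trans (lintegral_congr_ae ?_) h
  -- `u` is almost surely no point of the process, so that adding it adds one term to the sum.
  have hae : ∀ᵐ ω ∂P, u ∉ N ω := by
    rw [ae_iff]
    simpa using hN.measure_mem_eq_zero u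
  filter_upwards [hae] with ω hω
  rw [lintegral_countKernel_insert hω, hdiag, zero_add]
  rfl

end IsUnitPoissonProcess

end PoissonProcess

/-! ### The cones in coordinates along and across their axes -/

/-- The signed distance of `v` from the axis of `C_i`, positive to the left of the axis. -/
def offset (k : ℕ) (i : Fin k) (v : ℝ × ℝ) : ℝ :=
  -v.1 * Real.sin (axisAngle k i) + v.2 * Real.cos (axisAngle k i)

lemma measurable_height (k : ℕ) (i : Fin k) : Measurable (height k i) := by
  unfold height; fun_prop

lemma measurable_offset (k : ℕ) (i : Fin k) : Measurable (offset k i) := by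
  unfold offset; fun_prop

lemma height_polar (k : ℕ) (i : Fin k) (ρ φ : ℝ) :
    height k i (ρ * Real.cos φ, ρ * Real.sin φ) = ρ * Real.cos (φ - axisAngle k i) := by
  rw [height, Real.cos_sub]; ring

lemma offset_polar (k : ℕ) (i : Fin k) (ρ φ : ℝ) :
    offset k i (ρ * Real.cos φ, ρ * Real.sin φ) = ρ * Real.sin (φ - axisAngle k i) := by
  rw [offset, Real.sin_sub]; ring

lemma ext_height_offset {k : ℕ} {i : Fin k} {v w : ℝ × ℝ} (h : height k i v = height k i w)
    (h' : offset k i v = offset k i w) : v = w := by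
  simp only [height, offset] at h h'
  have hsq := Real.sin_sq_add_cos_sq (axisAngle k i)
  set s := Real.sin (axisAngle k i)
  set c := Real.cos (axisAngle k i)
  ext
  · linear_combination c * h - s * h' + (w.1 - v.1) * hsq
  · linear_combination s * h + c * h' + (w.2 - v.2) * hsq

lemma pi_div_pos {k : ℕ} (hk : 3 ≤ k) : 0 < Real.pi / k := by
  have : (0 : ℝ) < k := by positivity
  positivity

lemma pi_div_lt_pi_div_two {k : ℕ} (hk : 3 ≤ k) : Real.pi / k < Real.pi / 2 :=
  div_lt_div_of_pos_left Real.pi_pos two_pos (by exact_mod_cast (by omega : 2 < k))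

lemma lower_angle_eq (k : ℕ) (i : Fin k) :
    2 * Real.pi * (i : ℕ) / k = axisAngle k i - Real.pi / k := by
  rw [axisAngle]; ring

lemma upper_angle_eq (k : ℕ) (i : Fin k) :
    2 * Real.pi * ((i : ℕ) + 1) / k = axisAngle k i + Real.pi / k := by
  rw [axisAngle]; ring

lemma mem_cone_iff {k : ℕ} (hk : 3 ≤ k) (i : Fin k) (v : ℝ × ℝ) :
    v ∈ cone k i ↔ 0 < height k i v ∧
      -(Real.tan (Real.pi / k) * height k i v) ≤ offset k i v ∧
      offset k i v < Real.tan (Real.pi / k) * height k i v := by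
  have h0 := pi_div_pos hk
  have h2 := pi_div_lt_pi_div_two hk
  have hmem : Real.pi / k ∈ Ioo (-(Real.pi / 2)) (Real.pi / 2) := ⟨by linarith, h2⟩
  have hmem' : -(Real.pi / k) ∈ Ioo (-(Real.pi / 2)) (Real.pi / 2) := ⟨by linarith, by linarith⟩
  constructor
  · rintro ⟨ρ, hρ, φ, hφ, rfl⟩
    rw [lower_angle_eq, upper_angle_eq] at hφ
    rw [height_polar, offset_polar]
    set ψ := φ - axisAngle k i with hψ
    have hψ1 : -(Real.pi / k) ≤ ψ := by linarith [hφ.1]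
    have hψ2 : ψ < Real.pi / k := by linarith [hφ.2]
    have hψm : ψ ∈ Ioo (-(Real.pi / 2)) (Real.pi / 2) := ⟨by linarith, by linarith⟩
    have hc : 0 < Real.cos ψ := Real.cos_pos_of_mem_Ioo hψm
    have hpos : 0 < ρ * Real.cos ψ := by positivity
    have hs : ρ * Real.sin ψ = Real.tan ψ * (ρ * Real.cos ψ) := by
      rw [Real.tan_eq_sin_div_cos]; field_simp
    refine ⟨hpos, ?_, ?_⟩
    · rw [hs, ← neg_mul, ← Real.tan_neg]
      exact mul_le_mul_of_nonneg_right
        (Real.strictMonoOn_tan.monotoneOn hmem' hψm hψ1) hpos.le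
    · rw [hs]
      exact mul_lt_mul_of_pos_right (Real.strictMonoOn_tan hψm hmem hψ2) hpos
  · rintro ⟨hh, hlow, hup⟩
    set ψ := Real.arctan (offset k i v / height k i v) with hψ
    have hc : 0 < Real.cos ψ := Real.cos_arctan_pos _
    have htan : Real.tan ψ = offset k i v / height k i v := Real.tan_arctan _
    have hlow' : -Real.tan (Real.pi / k) ≤ offset k i v / height k i v := by
      rw [le_div_iff₀ hh]; linarith
    have hup' : offset k i v / height k i v < Real.tan (Real.pi / k) := by
      rwa [div_lt_iff₀ hh]
    refine ⟨height k i v / Real.cos ψ, by positivity, ψ + axisAngle k i, ?_, ?_⟩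
    · rw [lower_angle_eq, upper_angle_eq]
      have h3 : ψ < Real.pi / k := by
        rw [← Real.arctan_tan hmem.1 hmem.2]
        exact Real.arctan_strictMono hup'
      have h4 : -(Real.pi / k) ≤ ψ := by
        rw [← Real.arctan_tan hmem'.1 hmem'.2, Real.tan_neg]
        exact Real.arctan_strictMono.monotone hlow'
      constructor <;> linarith
    · refine ext_height_offset (k := k) (i := i) ?_ ?_
      · rw [height_polar, add_sub_cancel_right]
        field_simp
      · rw [offset_polar, add_sub_cancel_right]
        rw [Real.tan_eq_sin_div_cos] at htan
        field_simp at htan ⊢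
        linarith

lemma measurableSet_cone {k : ℕ} (hk : 3 ≤ k) (i : Fin k) : MeasurableSet (cone k i) := by
  have h : cone k i = {v | 0 < height k i v} ∩
      ({v | -(Real.tan (Real.pi / k) * height k i v) ≤ offset k i v} ∩
      {v | offset k i v < Real.tan (Real.pi / k) * height k i v}) := by
    ext v
    exact mem_cone_iff hk i v
  have h1 := measurable_height k i
  have h2 := measurable_offset k i
  rw [h]
  exact (measurableSet_lt measurable_const h1).inter
    ((measurableSet_le (h1.const_mul _).neg h2).inter (measurableSet_lt h2 (h1.const_mul _)))

lemma zero_notMem_cone (k : ℕ) (i : Fin k) : (0 : ℝ × ℝ) ∉ cone k i := by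
  rintro ⟨ρ, hρ, φ, -, h⟩
  have h1 : 0 = ρ * Real.cos φ := congrArg Prod.fst h
  have h2 : 0 = ρ * Real.sin φ := congrArg Prod.snd h
  have hsq : ρ ^ 2 = 0 := by
    linear_combination (-ρ ^ 2) * Real.sin_sq_add_cos_sq φ - ρ * Real.cos φ * h1 -
      ρ * Real.sin φ * h2
  exact (pow_pos hρ 2).ne' hsq

/-- Distinct cones are disjoint. -/
lemma eq_of_mem_cone {k : ℕ} {i j : Fin k} {v : ℝ × ℝ} (hi : v ∈ cone k i) (hj : v ∈ cone k j) :
    i = j := by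
  have hk : 0 < (k : ℝ) := by exact_mod_cast i.pos
  have key : ∀ l : Fin k, ∀ φ ∈ Ico (2 * Real.pi * (l : ℕ) / k) (2 * Real.pi * ((l : ℕ) + 1) / k),
      0 ≤ φ ∧ φ < 2 * Real.pi := by
    intro l φ hφ
    have hl : ((l : ℕ) : ℝ) + 1 ≤ k := by exact_mod_cast l.2
    refine ⟨le_trans (by positivity) hφ.1, lt_of_lt_of_le hφ.2 ?_⟩
    rw [div_le_iff₀ hk]
    exact mul_le_mul_of_nonneg_left hl (by positivity)
  have low : ∀ l l' : Fin k, ∀ φ, φ ∈ Ico (2 * Real.pi * (l : ℕ) / k)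
      (2 * Real.pi * ((l : ℕ) + 1) / k) → φ ∈ Ico (2 * Real.pi * (l' : ℕ) / k)
      (2 * Real.pi * ((l' : ℕ) + 1) / k) → (l : ℕ) ≤ l' := by
    intro l l' φ h h'
    have h1 := lt_of_le_of_lt h.1 h'.2
    rw [div_lt_div_iff_of_pos_right hk, mul_lt_mul_iff_right₀ (by positivity)] at h1
    have : (l : ℕ) < (l' : ℕ) + 1 := by exact_mod_cast h1
    omega
  obtain ⟨ρ, hρ, φ, hφ, rfl⟩ := hi
  obtain ⟨ρ', hρ', φ', hφ', h⟩ := hj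
  have h1 : ρ * Real.cos φ = ρ' * Real.cos φ' := congrArg Prod.fst h
  have h2 : ρ * Real.sin φ = ρ' * Real.sin φ' := congrArg Prod.snd h
  have hρρ : ρ = ρ' := by
    refine (sq_eq_sq₀ hρ.le hρ'.le).1 ?_
    have e1 := Real.sin_sq_add_cos_sq φ
    have e2 := Real.sin_sq_add_cos_sq φ'
    linear_combination (-ρ ^ 2) * e1 + ρ' ^ 2 * e2 + (ρ * Real.cos φ + ρ' * Real.cos φ') * h1 +
      (ρ * Real.sin φ + ρ' * Real.sin φ') * h2
  subst hρρ
  have hc := mul_left_cancel₀ hρ.ne' h1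
  have hs := mul_left_cancel₀ hρ.ne' h2
  -- Both angles lie in `[0, 2π)` and have the same sine and cosine, so they agree.
  have hcos : Real.cos (φ - φ') = 1 := by
    rw [Real.cos_sub, hc, hs]
    linear_combination Real.sin_sq_add_cos_sq φ'
  obtain ⟨ha, hb⟩ := key i φ hφ
  obtain ⟨ha', hb'⟩ := key j φ' hφ'
  have h0 := (Real.cos_eq_one_iff_of_lt_of_lt (by linarith) (by linarith)).1 hcos
  have hφφ : φ = φ' := by linarith
  subst hφφ
  exact Fin.ext (le_antisymm (low i j φ hφ hφ') (low j i φ hφ' hφ))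

/-- The points of the cone `C_i` that are closer to the origin than `v` in the sense of the
projection on the axis: their absence is what makes the origin choose `v`. -/
def region (k : ℕ) (i : Fin k) (v : ℝ × ℝ) : Set (ℝ × ℝ) :=
  {p | p ∈ cone k i ∧ height k i p < height k i v}

lemma chooses_iff (k : ℕ) (S : Set (ℝ × ℝ)) (i : Fin k) (u w : ℝ × ℝ) :
    Chooses k S i u w ↔ u ∈ S ∧ w ∈ S ∧ w - u ∈ cone k i ∧
      S ∩ {p | p - u ∈ region k i (w - u)} = ∅ := by
  simp only [Chooses, region, eq_empty_iff_forall_notMem, mem_inter_iff, mem_ofPred_eq, not_and,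
    not_lt]

/-- The points whose absence makes the origin and `v` choose each other. -/
def mutualRegion (k : ℕ) (i : Fin k) (v : ℝ × ℝ) : Set (ℝ × ℝ) :=
  region k i v ∪ {p | ∃ j, -v ∈ cone k j ∧ p - v ∈ region k j (-v)}

/-- Being mutual is the emptiness of one region: the cone in which `w` sees `u` is unique, so that
`w` chooses `u` in some cone if and only if it does so in every cone that contains `u`. -/
lemma chooses_and_exists_chooses_iff (k : ℕ) (S : Set (ℝ × ℝ)) (i : Fin k) (u w : ℝ × ℝ) :
    (Chooses k S i u w ∧ ∃ j, Chooses k S j w u) ↔ u ∈ S ∧ w ∈ S ∧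
      (w - u ∈ cone k i ∧ ∃ j, -(w - u) ∈ cone k j) ∧
      S ∩ {p | p - u ∈ mutualRegion k i (w - u)} = ∅ := by
  have hu : u - w = -(w - u) := (neg_sub w u).symm
  have hp : ∀ p, p - u - (w - u) = p - w := fun p => sub_sub_sub_cancel_right p w u
  have hsplit : S ∩ {p | p - u ∈ mutualRegion k i (w - u)} = ∅ ↔
      S ∩ {p | p - u ∈ region k i (w - u)} = ∅ ∧
        ∀ j, -(w - u) ∈ cone k j → S ∩ {p | p - w ∈ region k j (-(w - u))} = ∅ := by
    simp only [mutualRegion, eq_empty_iff_forall_notMem, mem_inter_iff, mem_ofPred_eq, mem_union,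
      not_and, not_or, not_exists, hp]
    constructor
    · exact fun h => ⟨fun p hp => (h p hp).1, fun j hj p hp => (h p hp).2 j hj⟩
    · exact fun h p hp => ⟨h.1 p hp, fun j hj => h.2 j hj p hp⟩
  rw [hsplit]
  simp only [chooses_iff, hu]
  constructor
  · rintro ⟨⟨hu, hw, hc, he⟩, j, -, -, hj, hje⟩
    refine ⟨hu, hw, ⟨hc, j, hj⟩, he, fun j' hj' => ?_⟩
    rw [eq_of_mem_cone hj' hj]
    exact hje
  · rintro ⟨hu, hw, ⟨hc, j, hj⟩, he, hall⟩
    exact ⟨⟨hu, hw, hc, he⟩, j, hw, hu, hj, hall j hj⟩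

lemma measurableSet_region {k : ℕ} (hk : 3 ≤ k) (i : Fin k) :
    MeasurableSet {q : (ℝ × ℝ) × (ℝ × ℝ) | q.2 ∈ region k i q.1} :=
  (measurable_snd (measurableSet_cone hk i)).inter
    (measurableSet_lt ((measurable_height k i).comp measurable_snd)
      ((measurable_height k i).comp measurable_fst))

lemma measurableSet_mutualRegion {k : ℕ} (hk : 3 ≤ k) (i : Fin k) :
    MeasurableSet {q : (ℝ × ℝ) × (ℝ × ℝ) | q.2 ∈ mutualRegion k i q.1} := by
  have h : {q : (ℝ × ℝ) × (ℝ × ℝ) | q.2 ∈ mutualRegion k i q.1} =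
      {q | q.2 ∈ region k i q.1} ∪ ⋃ j, {q | -q.1 ∈ cone k j} ∩
        (fun q => (-q.1, q.2 - q.1)) ⁻¹' {q | q.2 ∈ region k j q.1} := by
    ext q
    simp [mutualRegion]
  rw [h]
  refine (measurableSet_region hk i).union (MeasurableSet.iUnion fun j => ?_)
  exact (measurable_fst.neg (measurableSet_cone hk j)).inter
    ((measurable_fst.neg.prodMk (measurable_snd.sub measurable_fst)) (measurableSet_region hk j))

lemma zero_notMem_region (k : ℕ) (i : Fin k) (v : ℝ × ℝ) : (0 : ℝ × ℝ) ∉ region k i v :=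
  fun h => zero_notMem_cone k i h.1

lemma self_notMem_region (k : ℕ) (i : Fin k) (v : ℝ × ℝ) : v ∉ region k i v :=
  fun h => lt_irrefl _ h.2

lemma zero_notMem_mutualRegion (k : ℕ) (i : Fin k) (v : ℝ × ℝ) :
    (0 : ℝ × ℝ) ∉ mutualRegion k i v := by
  rintro (h | ⟨j, -, h⟩)
  · exact zero_notMem_region k i v h
  · rw [zero_sub] at h
    exact self_notMem_region k j _ h

lemma self_notMem_mutualRegion (k : ℕ) (i : Fin k) (v : ℝ × ℝ) : v ∉ mutualRegion k i v := by
  rintro (h | ⟨j, -, h⟩)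
  · exact self_notMem_region k i v h
  · rw [sub_self] at h
    exact zero_notMem_region k j _ h

/-! ### The expected number of pairs with an empty neighbourhood -/

/-- The number of pairs in `T` is a double sum over the points, whose measurability in `S` comes
from that of the counting kernel. -/
lemma coe_encard_eq_lintegral (S : Config) {T : Set ((ℝ × ℝ) × (ℝ × ℝ))}
    (hT : ∀ e ∈ T, e.1 ∈ S.points ∧ e.2 ∈ S.points) :
    (T.encard : ℝ≥0∞) =
      ∫⁻ u, ∫⁻ w, T.indicator 1 (u, w) ∂countKernel S ∂countKernel S := by
  simp_rw [lintegral_countKernel]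
  rw [← ENNReal.tsum_prod (f := fun (u w : S.points) => T.indicator 1 ((u : ℝ × ℝ), (w : ℝ × ℝ))),
    ← ENNReal.tsum_set_one, tsum_subtype T (fun _ => (1 : ℝ≥0∞)),
    ← (Equiv.Set.prod S.points S.points).tsum_eq]
  have h := tsum_subtype (S.points ×ˢ S.points) (T.indicator (1 : (ℝ × ℝ) × (ℝ × ℝ) → ℝ≥0∞))
  refine Eq.trans ?_ h.symm
  rw [indicator_indicator, inter_eq_right.2]
  · rfl
  · exact fun e he => hT e he

lemma measurableSet_void_family {G : ℝ × ℝ → Set (ℝ × ℝ)}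
    (hG : MeasurableSet {q : (ℝ × ℝ) × (ℝ × ℝ) | q.2 ∈ G q.1}) :
    MeasurableSet {p : (Config × (ℝ × ℝ)) × (ℝ × ℝ) |
      p.1.1.points ∩ {x | x - p.1.2 ∈ G (p.2 - p.1.2)} = ∅} := by
  have hD : MeasurableSet {q : ((Config × (ℝ × ℝ)) × (ℝ × ℝ)) × (ℝ × ℝ) |
      q.2 - q.1.1.2 ∈ G (q.1.2 - q.1.1.2)} := by
    refine Measurable.prodMk (?_ : Measurable fun q : ((Config × (ℝ × ℝ)) × (ℝ × ℝ)) × (ℝ × ℝ) =>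
      q.1.2 - q.1.1.2) (?_ : Measurable fun q : ((Config × (ℝ × ℝ)) × (ℝ × ℝ)) × (ℝ × ℝ) =>
      q.2 - q.1.1.2) hG <;> fun_prop
  let κ : Kernel ((Config × (ℝ × ℝ)) × (ℝ × ℝ)) (ℝ × ℝ) :=
    countKernel.comap (fun p => p.1.1) (measurable_fst.comp measurable_fst)
  have hmeas := Kernel.measurable_kernel_prodMk_left (κ := κ) hD
  have h : {p : (Config × (ℝ × ℝ)) × (ℝ × ℝ) |
      p.1.1.points ∩ {x | x - p.1.2 ∈ G (p.2 - p.1.2)} = ∅} =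
      (fun p => κ p (Prod.mk p ⁻¹' {q | q.2 - q.1.1.2 ∈ G (q.1.2 - q.1.1.2)})) ⁻¹' {0} := by
    ext p
    rw [mem_preimage, mem_singleton_iff, Kernel.comap_apply,
      countKernel_apply _ (measurable_prodMk_left hD)]
    simp
  rw [h]
  exact hmeas (measurableSet_singleton 0)

/-- The expected number of pairs `(u, w)` of points of a Poisson process with `u ∈ W` and
`w - u ∈ C` for which no point of the process lies in `u + G (w - u)`. -/
theorem IsUnitPoissonProcess.lintegral_encard_pairs {Ω : Type*} [MeasurableSpace Ω]
    {P : Measure Ω} [IsProbabilityMeasure P] {N : Ω → Set (ℝ × ℝ)}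
    (hN : IsUnitPoissonProcess P N) {W C : Set (ℝ × ℝ)} (hW : MeasurableSet W)
    (hC : MeasurableSet C) {G : ℝ × ℝ → Set (ℝ × ℝ)}
    (hG : MeasurableSet {q : (ℝ × ℝ) × (ℝ × ℝ) | q.2 ∈ G q.1}) (hC0 : (0 : ℝ × ℝ) ∉ C)
    (hG0 : ∀ v, (0 : ℝ × ℝ) ∉ G v) (hGv : ∀ v, v ∉ G v) (hfin : ∀ v ∈ C, volume (G v) ≠ ∞) :
    ∫⁻ ω, ({e : (ℝ × ℝ) × (ℝ × ℝ) | e.1 ∈ W ∧ e.1 ∈ N ω ∧ e.2 ∈ N ω ∧ e.2 - e.1 ∈ C ∧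
        N ω ∩ {p | p - e.1 ∈ G (e.2 - e.1)} = ∅}.encard : ℝ≥0∞) ∂P =
      volume W * ∫⁻ v in C, ENNReal.ofReal (Real.exp (-(volume (G v)).toReal)) := by
  -- The two-point Mecke formula is applied to the indicator of `D`.
  set D : Set ((Config × (ℝ × ℝ)) × (ℝ × ℝ)) :=
    {p | p.1.2 ∈ W ∧ p.2 - p.1.2 ∈ C ∧
      p.1.1.points ∩ {x | x - p.1.2 ∈ G (p.2 - p.1.2)} = ∅} with hDdef
  have hD : MeasurableSet D :=
    ((measurable_snd.comp measurable_fst) hW).inter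
      (((measurable_snd.sub (measurable_snd.comp measurable_fst)) hC).inter
        (measurableSet_void_family hG))
  have hF : Measurable (D.indicator (1 : (Config × (ℝ × ℝ)) × (ℝ × ℝ) → ℝ≥0∞)) :=
    measurable_one.indicator hD
  have hstart : ∀ ω, ({e : (ℝ × ℝ) × (ℝ × ℝ) | e.1 ∈ W ∧ e.1 ∈ N ω ∧ e.2 ∈ N ω ∧ e.2 - e.1 ∈ C ∧
        N ω ∩ {p | p - e.1 ∈ G (e.2 - e.1)} = ∅}.encard : ℝ≥0∞) =
      ∫⁻ u, ∫⁻ w, D.indicator 1 ((hN.config ω, u), w) ∂countKernel (hN.config ω)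
        ∂countKernel (hN.config ω) := by
    intro ω
    rw [coe_encard_eq_lintegral (hN.config ω) fun e he => ⟨he.2.1, he.2.2.1⟩]
    simp_rw [lintegral_countKernel]
    refine tsum_congr fun u => tsum_congr fun w => ?_
    have hu : (u : ℝ × ℝ) ∈ N ω := u.2
    have hw : (w : ℝ × ℝ) ∈ N ω := w.2
    simp only [indicator, Pi.one_apply]
    congr 1
    simp [hDdef, hu, hw, hN.config_points]
  simp_rw [hstart]
  rw [hN.lintegral_countKernel_countKernel_eq hF]
  swap
  · intro S u
    simp [hDdef, hC0]
  -- The added points `u` and `w` are not in the region, so that a void probability remains.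
  have hinner : ∀ u w, ∫⁻ ω, D.indicator 1 ((((hN.config ω).insert w).insert u, u), w) ∂P =
      W.indicator 1 u * C.indicator
        (fun v => ENNReal.ofReal (Real.exp (-(volume (G v)).toReal))) (w - u) := by
    intro u w
    by_cases hu : u ∈ W
    swap
    · simp [hDdef, hu]
    by_cases hv : w - u ∈ C
    swap
    · simp [hDdef, hv]
    have hGm : MeasurableSet (G (w - u)) := measurable_prodMk_left (x := w - u) hG
    have hGm' : MeasurableSet {x | x - u ∈ G (w - u)} := (measurable_id.sub_const u) hGm
    have hvol : volume {x | x - u ∈ G (w - u)} = volume (G (w - u)) :=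
      (measurePreserving_sub_right volume u).measure_preimage hGm.nullMeasurableSet
    have heq : ∀ ω, D.indicator (1 : (Config × (ℝ × ℝ)) × (ℝ × ℝ) → ℝ≥0∞)
        ((((hN.config ω).insert w).insert u, u), w) =
        {ω | N ω ∩ {x | x - u ∈ G (w - u)} = ∅}.indicator 1 ω := by
      intro ω
      simp [indicator, hDdef, hu, hv, Config.insert_points, insert_inter_eq_empty_iff, hG0, hGv,
        hN.config_points]
    simp_rw [heq]
    have hV : MeasurableSet {ω | N ω ∩ {x | x - u ∈ G (w - u)} = ∅} :=
      hN.measurable_config (measurableSet_void hGm')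
    rw [lintegral_indicator_one hV, hN.measure_void hGm' (by rw [hvol]; exact hfin _ hv), hvol]
    simp [hu, hv]
  have hmeas : Measurable (C.indicator
      (fun v => ENNReal.ofReal (Real.exp (-(volume (G v)).toReal)))) :=
    (ENNReal.measurable_ofReal.comp (Real.measurable_exp.comp
      (measurable_measure_prodMk_left hG).ennreal_toReal.neg)).indicator hC
  simp_rw [hinner]
  have hint : ∀ u : ℝ × ℝ, ∫⁻ w, W.indicator 1 u * C.indicator
        (fun v => ENNReal.ofReal (Real.exp (-(volume (G v)).toReal))) (w - u) =
      W.indicator 1 u * ∫⁻ v in C, ENNReal.ofReal (Real.exp (-(volume (G v)).toReal)) := by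
    intro u
    have hmeas' : Measurable fun w => C.indicator
        (fun v => ENNReal.ofReal (Real.exp (-(volume (G v)).toReal))) (w - u) :=
      hmeas.comp (measurable_id.sub_const u)
    rw [lintegral_const_mul _ hmeas',
      lintegral_sub_right_eq_self (C.indicator
        (fun v => ENNReal.ofReal (Real.exp (-(volume (G v)).toReal)))) u,
      lintegral_indicator hC]
  simp_rw [hint]
  rw [lintegral_mul_const _ (measurable_one.indicator hW), lintegral_indicator_one hW]

/-! ### Areas of triangles -/

lemma setLIntegral_ofReal_sub {c : ℝ} (hc : 0 ≤ c) :
    ∫⁻ x in Icc 0 c, ENNReal.ofReal (c - x) = ENNReal.ofReal (c ^ 2 / 2) := by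
  rw [← ofReal_integral_eq_lintegral_ofReal]
  · rw [integral_Icc_eq_integral_Ioc, ← intervalIntegral.integral_of_le hc]
    have h : ∫ x in (0 : ℝ)..c, (c - x) = c ^ 2 / 2 := by
      rw [intervalIntegral.integral_sub (by simp) (by simp)]
      simp
      ring
    rw [h]
  · exact (continuous_const.sub continuous_id).continuousOn.integrableOn_Icc
  · exact (ae_restrict_iff' measurableSet_Icc).2 (ae_of_all _ fun x hx => sub_nonneg.2 hx.2)

lemma volume_closed_simplex {c : ℝ} (hc : 0 ≤ c) :
    volume {p : ℝ × ℝ | 0 ≤ p.1 ∧ 0 ≤ p.2 ∧ p.1 + p.2 ≤ c} = ENNReal.ofReal (c ^ 2 / 2) := by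
  have hm : MeasurableSet {p : ℝ × ℝ | 0 ≤ p.1 ∧ 0 ≤ p.2 ∧ p.1 + p.2 ≤ c} := by measurability
  rw [Measure.volume_eq_prod, Measure.prod_apply hm, ← setLIntegral_ofReal_sub hc,
    ← lintegral_indicator measurableSet_Icc]
  refine lintegral_congr fun x => ?_
  by_cases hx : x ∈ Icc 0 c
  · have h : Prod.mk x ⁻¹' {p : ℝ × ℝ | 0 ≤ p.1 ∧ 0 ≤ p.2 ∧ p.1 + p.2 ≤ c} = Icc 0 (c - x) := by
      ext y
      simp only [mem_preimage, mem_ofPred_eq, mem_Icc]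
      exact ⟨fun h => ⟨h.2.1, by linarith⟩, fun h => ⟨hx.1, h.1, by linarith⟩⟩
    rw [h, Real.volume_Icc, indicator_of_mem hx, sub_zero]
  · have h : Prod.mk x ⁻¹' {p : ℝ × ℝ | 0 ≤ p.1 ∧ 0 ≤ p.2 ∧ p.1 + p.2 ≤ c} = ∅ := by
      ext y
      simp only [mem_preimage, mem_ofPred_eq, mem_empty_iff_false, iff_false]
      exact fun h => hx ⟨h.1, by linarith⟩
    rw [h, measure_empty, indicator_of_notMem hx]

lemma volume_open_simplex {c : ℝ} (hc : 0 ≤ c) :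
    volume {p : ℝ × ℝ | 0 < p.1 ∧ 0 < p.2 ∧ p.1 + p.2 < c} = ENNReal.ofReal (c ^ 2 / 2) := by
  have hm : MeasurableSet {p : ℝ × ℝ | 0 < p.1 ∧ 0 < p.2 ∧ p.1 + p.2 < c} := by measurability
  rw [Measure.volume_eq_prod, Measure.prod_apply hm, ← setLIntegral_ofReal_sub hc,
    ← setLIntegral_congr Ioo_ae_eq_Icc, ← lintegral_indicator measurableSet_Ioo]
  refine lintegral_congr fun x => ?_
  by_cases hx : x ∈ Ioo 0 c
  · have h : Prod.mk x ⁻¹' {p : ℝ × ℝ | 0 < p.1 ∧ 0 < p.2 ∧ p.1 + p.2 < c} = Ioo 0 (c - x) := by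
      ext y
      simp only [mem_preimage, mem_ofPred_eq, mem_Ioo]
      exact ⟨fun h => ⟨h.2.1, by linarith⟩, fun h => ⟨hx.1, h.1, by linarith⟩⟩
    rw [h, Real.volume_Ioo, indicator_of_mem hx, sub_zero]
  · have h : Prod.mk x ⁻¹' {p : ℝ × ℝ | 0 < p.1 ∧ 0 < p.2 ∧ p.1 + p.2 < c} = ∅ := by
      ext y
      simp only [mem_preimage, mem_ofPred_eq, mem_empty_iff_false, iff_false]
      exact fun h => hx ⟨h.1, by linarith⟩
    rw [h, measure_empty, indicator_of_notMem hx]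

/-- The linear map of the plane with matrix `!![a, b; a', b']`. -/
def planeMap (a b a' b' : ℝ) : ℝ × ℝ →ₗ[ℝ] ℝ × ℝ :=
  Matrix.toLin (Module.Basis.finTwoProd ℝ) (Module.Basis.finTwoProd ℝ) !![a, b; a', b']

lemma planeMap_apply (a b a' b' : ℝ) (p : ℝ × ℝ) :
    planeMap a b a' b' p = (a * p.1 + b * p.2, a' * p.1 + b' * p.2) :=
  Matrix.toLin_finTwoProd_apply _ _ _ _ _

lemma volume_preimage_planeMap {a b a' b' : ℝ} (hd : a * b' - b * a' ≠ 0) (s : Set (ℝ × ℝ)) :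
    volume (planeMap a b a' b' ⁻¹' s) =
      ENNReal.ofReal |(a * b' - b * a')⁻¹| * volume s := by
  have hdet : LinearMap.det (planeMap a b a' b') = a * b' - b * a' := by
    rw [planeMap, LinearMap.det_toLin, Matrix.det_fin_two_of]
  rw [Measure.addHaar_preimage_linearMap volume (by rwa [hdet]), hdet]

lemma volume_preimage_affine {a b e a' b' e' : ℝ} (hd : a * b' - b * a' ≠ 0)
    (s : Set (ℝ × ℝ)) (hs : MeasurableSet s) :
    volume {p : ℝ × ℝ | (a * p.1 + b * p.2 + e, a' * p.1 + b' * p.2 + e') ∈ s} =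
      ENNReal.ofReal |(a * b' - b * a')⁻¹| * volume s := by
  have h : {p : ℝ × ℝ | (a * p.1 + b * p.2 + e, a' * p.1 + b' * p.2 + e') ∈ s} =
      planeMap a b a' b' ⁻¹' ((fun q => q + (e, e')) ⁻¹' s) := by
    ext p
    simp [planeMap_apply]
  rw [h, volume_preimage_planeMap hd,
    (measurePreserving_add_right volume (e, e')).measure_preimage hs.nullMeasurableSet]

/-- The area of the closed triangle cut out by two affine functions `l`, `l'` as `0 ≤ l`, `0 ≤ l'`,
`l + l' ≤ c`. -/
lemma volume_closed_triangle {a b e a' b' e' c d : ℝ} (hd : |a * b' - b * a'| = d) (hd0 : 0 < d)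
    (hc : 0 ≤ c) :
    volume {p : ℝ × ℝ | 0 ≤ a * p.1 + b * p.2 + e ∧ 0 ≤ a' * p.1 + b' * p.2 + e' ∧
      (a * p.1 + b * p.2 + e) + (a' * p.1 + b' * p.2 + e') ≤ c} =
      ENNReal.ofReal (c ^ 2 / (2 * d)) := by
  have h := volume_preimage_affine (e := e) (e' := e') (abs_pos.1 (hd ▸ hd0))
    {p : ℝ × ℝ | 0 ≤ p.1 ∧ 0 ≤ p.2 ∧ p.1 + p.2 ≤ c} (by measurability)
  rw [volume_closed_simplex hc, ← ENNReal.ofReal_mul (abs_nonneg _), abs_inv, hd] at h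
  refine Eq.trans h ?_
  congr 1
  field_simp

/-- The area of the open triangle cut out by two affine functions `l`, `l'` as `0 < l`, `0 < l'`,
`l + l' < c`. -/
lemma volume_open_triangle {a b e a' b' e' c d : ℝ} (hd : |a * b' - b * a'| = d) (hd0 : 0 < d)
    (hc : 0 ≤ c) :
    volume {p : ℝ × ℝ | 0 < a * p.1 + b * p.2 + e ∧ 0 < a' * p.1 + b' * p.2 + e' ∧
      (a * p.1 + b * p.2 + e) + (a' * p.1 + b' * p.2 + e') < c} =
      ENNReal.ofReal (c ^ 2 / (2 * d)) := by
  have h := volume_preimage_affine (e := e) (e' := e') (abs_pos.1 (hd ▸ hd0))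
    {p : ℝ × ℝ | 0 < p.1 ∧ 0 < p.2 ∧ p.1 + p.2 < c} (by measurability)
  rw [volume_open_simplex hc, ← ENNReal.ofReal_mul (abs_nonneg _), abs_inv, hd] at h
  refine Eq.trans h ?_
  congr 1
  field_simp

/-- A set has the area of an open set inside it and a closed set around it if these have the same
area. Here both are given in the coordinates `Φ`. -/
lemma volume_eq_of_between {Φ : ℝ × ℝ → ℝ × ℝ} (hΦ : MeasurePreserving Φ)
    {I O T : Set (ℝ × ℝ)} {A : ℝ≥0∞} (hI : MeasurableSet I) (hO : MeasurableSet O)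
    (hIA : A ≤ volume I) (hOA : volume O ≤ A) (hIT : ∀ p, Φ p ∈ I → p ∈ T)
    (hTO : ∀ p ∈ T, Φ p ∈ O) : volume T = A := by
  refine le_antisymm (le_trans (measure_mono hTO) ?_) (le_trans ?_ (measure_mono hIT))
  · exact (hΦ.measure_preimage hO.nullMeasurableSet).trans_le hOA
  · exact hIA.trans_eq (hΦ.measure_preimage hI.nullMeasurableSet).symm

/-- The open isosceles triangle with apex `0`, axis the positive `x`-axis, half-angle `θ` and height
`h`, where `s = sin θ` and `c = cos θ`. -/
def openTriangle (s c h : ℝ) : Set (ℝ × ℝ) :=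
  {p | p.1 < h ∧ 0 < s * p.1 - c * p.2 ∧ 0 < s * p.1 + c * p.2}

/-- The closed version of `openTriangle`. -/
def closedTriangle (s c h : ℝ) : Set (ℝ × ℝ) :=
  {p | p.1 ≤ h ∧ 0 ≤ s * p.1 - c * p.2 ∧ 0 ≤ s * p.1 + c * p.2}

/-- The open isosceles triangle with apex `(h, y)` and half-angle `θ` (`s = sin θ`, `c = cos θ`)
one side of which points in the direction of the negative `x`-axis, the other one being below it,
and whose base lies on a line through the origin. -/
def openBackTriangle (s c h y : ℝ) : Set (ℝ × ℝ) :=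
  {p | 0 < y - p.2 ∧ 0 < 2 * s * c * (h - p.1) - (c ^ 2 - s ^ 2) * (y - p.2) ∧
    0 < c * p.1 + s * p.2}

/-- The closed version of `openBackTriangle`. -/
def closedBackTriangle (s c h y : ℝ) : Set (ℝ × ℝ) :=
  {p | 0 ≤ y - p.2 ∧ 0 ≤ 2 * s * c * (h - p.1) - (c ^ 2 - s ^ 2) * (y - p.2) ∧
    0 ≤ c * p.1 + s * p.2}

/-- The area of the union of the two triangles `openTriangle s c h` and `openBackTriangle s c h y`,
when `(h, y)` is on the far side of the first one, not below its axis, and `s < c`.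
The summands are the area of the second triangle and of the two triangles, above and below it, into
which it divides the rest of the first one. -/
def unionArea (s c h y : ℝ) : ℝ :=
  s / c * (c * h + s * y) ^ 2 + (s * h - c * y) ^ 2 / (2 * (s * c)) +
    (c ^ 2 - s ^ 2) * (c * y + s * h) ^ 2 / (2 * (s * c * (3 * c ^ 2 - s ^ 2)))

lemma volume_openTriangle {s c h : ℝ} (hs : 0 < s) (hc : 0 < c) (hh : 0 ≤ h) :
    volume (openTriangle s c h) = ENNReal.ofReal (s / c * h ^ 2) := by
  have h1 := volume_open_triangle (a := s) (b := -c) (e := 0) (a' := s) (b' := c) (e' := 0)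
    (c := 2 * s * h) (d := 2 * (s * c))
    (by rw [abs_of_pos] <;> nlinarith [mul_pos hs hc]) (by positivity) (by positivity)
  have h2 : (2 * s * h) ^ 2 / (2 * (2 * (s * c))) = s / c * h ^ 2 := by field_simp
  rw [h2] at h1
  rw [← h1]
  congr 1
  ext p
  simp only [openTriangle, mem_ofPred_eq]
  constructor
  · rintro ⟨ha, hb, hc⟩
    exact ⟨by linarith, by linarith, by nlinarith⟩
  · rintro ⟨ha, hb, hc⟩
    exact ⟨by nlinarith, by linarith, by linarith⟩

lemma volume_closedTriangle {s c h : ℝ} (hs : 0 < s) (hc : 0 < c) (hh : 0 ≤ h) :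
    volume (closedTriangle s c h) = ENNReal.ofReal (s / c * h ^ 2) := by
  have h1 := volume_closed_triangle (a := s) (b := -c) (e := 0) (a' := s) (b' := c) (e' := 0)
    (c := 2 * s * h) (d := 2 * (s * c))
    (by rw [abs_of_pos] <;> nlinarith [mul_pos hs hc]) (by positivity) (by positivity)
  have h2 : (2 * s * h) ^ 2 / (2 * (2 * (s * c))) = s / c * h ^ 2 := by field_simp
  rw [h2] at h1
  rw [← h1]
  congr 1
  ext p
  simp only [closedTriangle, mem_ofPred_eq]
  constructor
  · rintro ⟨ha, hb, hc⟩
    exact ⟨by linarith, by linarith, by nlinarith⟩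
  · rintro ⟨ha, hb, hc⟩
    exact ⟨by nlinarith, by linarith, by linarith⟩

section Union

variable {s c h y : ℝ}

/-- The area of the second triangle, as `volume_open_triangle` gives it, is the first summand of
`unionArea`. -/
lemma area_back_eq (hs : 0 < s) (hc : 0 < c) :
    (2 * s * (c * h + s * y)) ^ 2 / (2 * (2 * s * c)) = s / c * (c * h + s * y) ^ 2 := by
  field_simp

/-- The area of the part of the first triangle below the second one, as `volume_open_triangle` gives
it, is the last summand of `unionArea`. -/
lemma area_bottom_eq (hs : 0 < s) (hc : 0 < c) (hC : 0 < c ^ 2 - s ^ 2) :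
    ((c ^ 2 - s ^ 2) * (c * y + s * h)) ^ 2 /
        (2 * (s * (3 * c ^ 2 - s ^ 2) * (c * (c ^ 2 - s ^ 2)))) =
      (c ^ 2 - s ^ 2) * (c * y + s * h) ^ 2 / (2 * (s * c * (3 * c ^ 2 - s ^ 2))) := by
  field_simp

/-- The second triangle and the parts of the first one above and below it are disjoint. -/
lemma unionArea_le_volume (hs : 0 < s) (hsc : s < c) (h1 : s ^ 2 + c ^ 2 = 1) (hh : 0 ≤ h)
    (hy : 0 ≤ y) (hyh : c * y ≤ s * h) :
    ENNReal.ofReal (unionArea s c h y) ≤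
      volume (openTriangle s c h ∪ openBackTriangle s c h y) := by
  have hc : 0 < c := hs.trans hsc
  have hC : 0 < c ^ 2 - s ^ 2 := by nlinarith
  have hm : 0 < 3 * c ^ 2 - s ^ 2 := by nlinarith
  -- The second triangle `B` and the parts `T`, `L` of the first one above and below it are put in
  -- the form `0 < l`, `0 < l'`, `l + l' < const`. For `L`, `l` is `h - x` scaled by
  -- `s * (3 * c ^ 2 - s ^ 2) = sin (3θ)`.
  have hback := volume_open_triangle (a := 0) (b := -1) (e := y) (a' := -(2 * s * c))
    (b' := c ^ 2 - s ^ 2) (e' := 2 * s * c * h - (c ^ 2 - s ^ 2) * y)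
    (c := 2 * s * (c * h + s * y)) (d := 2 * s * c)
    (by rw [abs_of_neg] <;> nlinarith [mul_pos hs hc]) (by positivity) (by positivity)
  have htop := volume_open_triangle (a := 0) (b := c) (e := -(c * y)) (a' := s) (b' := -c) (e' := 0)
    (c := s * h - c * y) (d := s * c)
    (by rw [abs_of_neg] <;> nlinarith [mul_pos hs hc]) (by positivity) (by linarith)
  have hbot := volume_open_triangle (a := -(s * (3 * c ^ 2 - s ^ 2))) (b := 0)
    (e := s * (3 * c ^ 2 - s ^ 2) * h) (a' := c * (2 * s * c)) (b' := -(c * (c ^ 2 - s ^ 2)))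
    (e' := c * ((c ^ 2 - s ^ 2) * y - 2 * s * c * h))
    (c := (c ^ 2 - s ^ 2) * (c * y + s * h)) (d := s * (3 * c ^ 2 - s ^ 2) * (c * (c ^ 2 - s ^ 2)))
    (by rw [zero_mul, sub_zero, neg_mul_neg, abs_of_pos (by positivity)]) (by positivity)
    (by positivity)
  rw [area_back_eq hs hc] at hback
  rw [area_bottom_eq hs hc hC] at hbot
  set B := {p : ℝ × ℝ | 0 < 0 * p.1 + -1 * p.2 + y ∧ _}
  set T := {p : ℝ × ℝ | 0 < 0 * p.1 + c * p.2 + -(c * y) ∧ _}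
  set L := {p : ℝ × ℝ | 0 < -(s * (3 * c ^ 2 - s ^ 2)) * p.1 + 0 * p.2 + _ ∧ _}
  have hTm : MeasurableSet T := by measurability
  have hLm : MeasurableSet L := by measurability
  have hBT : Disjoint B T := disjoint_left.2 fun p hp hp' => by
    have e1 := hp.1
    have e2 := hp'.1
    nlinarith
  have hBL : Disjoint B L := disjoint_left.2 fun p hp hp' => by
    have e1 := hp.2.1
    have e2 := hp'.2.1
    nlinarith
  have hTL : Disjoint T L := disjoint_left.2 fun p hp hp' => by
    have e1 := hp.1
    have e2 := hp'.1
    have e3 := hp'.2.1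
    have e4 : 0 < h - p.1 := by
      have : 0 < s * (3 * c ^ 2 - s ^ 2) * (h - p.1) := by linarith
      exact (pos_iff_pos_of_mul_pos this).1 (by positivity)
    have e5 : 0 < p.2 - y := by
      have : 0 < c * (p.2 - y) := by linarith
      exact (pos_iff_pos_of_mul_pos this).1 hc
    have e6 : 0 < c * ((c ^ 2 - s ^ 2) * (p.2 - y)) := by positivity
    have e7 : 0 < c * (2 * s * c * (h - p.1)) := by positivity
    linarith
  have hsub : B ∪ (T ∪ L) ⊆ openTriangle s c h ∪ openBackTriangle s c h y := by
    rintro p (⟨e1, e2, e3⟩ | ⟨e1, e2, e3⟩ | ⟨e1, e2, e3⟩)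
    · right
      refine ⟨by linarith, by linarith, ?_⟩
      have : 0 < 2 * s * (c * p.1 + s * p.2) := by
        have h2 : c ^ 2 = 1 - s ^ 2 := by linarith
        rw [h2] at e3
        linarith
      exact (pos_iff_pos_of_mul_pos this).1 (by positivity)
    · left
      have e4 : 0 < s * (h - p.1) := by linarith
      have e5 : 0 < c * p.2 := by nlinarith
      refine ⟨by linarith [(pos_iff_pos_of_mul_pos e4).1 hs], by linarith, by linarith⟩
    · left
      have e4 : 0 < h - p.1 := by
        have : 0 < s * (3 * c ^ 2 - s ^ 2) * (h - p.1) := by linarith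
        exact (pos_iff_pos_of_mul_pos this).1 (by positivity)
      have e5 : 0 < (c ^ 2 - s ^ 2) * (s * p.1 + c * p.2) := by linarith
      have e6 : 0 < s * p.1 + c * p.2 := (pos_iff_pos_of_mul_pos e5).1 hC
      refine ⟨by linarith, ?_, e6⟩
      have e7 : 0 ≤ (c ^ 2 - s ^ 2) * (s * h - c * y) := mul_nonneg hC.le (by linarith)
      have e8 : 0 < s * ((c ^ 2 + s ^ 2) * (h - p.1)) := by positivity
      have e9 : 0 < (c ^ 2 - s ^ 2) * (s * p.1 - c * p.2) := by linarith
      exact (pos_iff_pos_of_mul_pos e9).1 hC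
  refine le_trans (le_of_eq ?_) (measure_mono hsub)
  rw [measure_union (disjoint_union_right.2 ⟨hBT, hBL⟩) (hTm.union hLm), measure_union hTL hLm,
    hback, htop, hbot, unionArea, add_assoc, ENNReal.ofReal_add (by positivity) (by positivity),
    ENNReal.ofReal_add (by positivity) (by positivity)]

/-- The second triangle and the parts of the first one above and below it cover the union. -/
lemma volume_le_unionArea (hs : 0 < s) (hsc : s < c) (h1 : s ^ 2 + c ^ 2 = 1) (hh : 0 ≤ h)
    (hy : 0 ≤ y) (hyh : c * y ≤ s * h) :
    volume (closedTriangle s c h ∪ closedBackTriangle s c h y) ≤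
      ENNReal.ofReal (unionArea s c h y) := by
  have hc : 0 < c := hs.trans hsc
  have hC : 0 < c ^ 2 - s ^ 2 := by nlinarith
  have hm : 0 < 3 * c ^ 2 - s ^ 2 := by nlinarith
  -- The second triangle `B` and the parts `T`, `L` of the first one above and below it are put in
  -- the form `0 ≤ l`, `0 ≤ l'`, `l + l' ≤ const`. For `L`, `l` is `h - x` scaled by
  -- `s * (3 * c ^ 2 - s ^ 2) = sin (3θ)`.
  have hback := volume_closed_triangle (a := 0) (b := -1) (e := y) (a' := -(2 * s * c))
    (b' := c ^ 2 - s ^ 2) (e' := 2 * s * c * h - (c ^ 2 - s ^ 2) * y)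
    (c := 2 * s * (c * h + s * y)) (d := 2 * s * c)
    (by rw [abs_of_neg] <;> nlinarith [mul_pos hs hc]) (by positivity) (by positivity)
  have htop := volume_closed_triangle (a := 0) (b := c) (e := -(c * y)) (a' := s) (b' := -c)
    (e' := 0) (c := s * h - c * y) (d := s * c)
    (by rw [abs_of_neg] <;> nlinarith [mul_pos hs hc]) (by positivity) (by linarith)
  have hbot := volume_closed_triangle (a := -(s * (3 * c ^ 2 - s ^ 2))) (b := 0)
    (e := s * (3 * c ^ 2 - s ^ 2) * h) (a' := c * (2 * s * c)) (b' := -(c * (c ^ 2 - s ^ 2)))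
    (e' := c * ((c ^ 2 - s ^ 2) * y - 2 * s * c * h))
    (c := (c ^ 2 - s ^ 2) * (c * y + s * h)) (d := s * (3 * c ^ 2 - s ^ 2) * (c * (c ^ 2 - s ^ 2)))
    (by rw [zero_mul, sub_zero, neg_mul_neg, abs_of_pos (by positivity)]) (by positivity)
    (by positivity)
  rw [area_back_eq hs hc] at hback
  rw [area_bottom_eq hs hc hC] at hbot
  set B := {p : ℝ × ℝ | 0 ≤ 0 * p.1 + -1 * p.2 + y ∧ _}
  set T := {p : ℝ × ℝ | 0 ≤ 0 * p.1 + c * p.2 + -(c * y) ∧ _}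
  set L := {p : ℝ × ℝ | 0 ≤ -(s * (3 * c ^ 2 - s ^ 2)) * p.1 + 0 * p.2 + _ ∧ _}
  have hBback : closedBackTriangle s c h y ⊆ B := by
    rintro p ⟨e1, e2, e3⟩
    refine ⟨by linarith, by linarith, ?_⟩
    have h2 : c ^ 2 = 1 - s ^ 2 := by linarith
    rw [h2]
    have : 0 ≤ 2 * s * (c * p.1 + s * p.2) := by positivity
    linarith
  have hsub : closedTriangle s c h ∪ closedBackTriangle s c h y ⊆ B ∪ (T ∪ L) := by
    rintro p (⟨e1, e2, e3⟩ | hp)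
    · rcases le_total y p.2 with hyp | hyp
      · right; left
        have e4 : 0 ≤ c * (p.2 - y) := mul_nonneg hc.le (by linarith)
        have e5 : 0 ≤ s * (h - p.1) := mul_nonneg hs.le (by linarith)
        exact ⟨by linarith, by linarith, by linarith⟩
      · rcases le_total ((c ^ 2 - s ^ 2) * (y - p.2)) (2 * s * c * (h - p.1)) with hl | hl
        · left
          refine hBback ⟨by linarith, by linarith, ?_⟩
          have hx : 0 ≤ p.1 := by
            have : 0 ≤ s * p.1 := by linarith
            exact nonneg_of_mul_nonneg_right this hs
          have e4 : 0 ≤ s * (s * p.1 + c * p.2) + (c ^ 2 - s ^ 2) * p.1 := by positivity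
          have e5 : 0 ≤ c * (c * p.1 + s * p.2) := by linarith
          exact nonneg_of_mul_nonneg_right e5 hc
        · right; right
          have e4 : 0 ≤ s * (3 * c ^ 2 - s ^ 2) * (h - p.1) :=
            mul_nonneg (by positivity) (by linarith)
          have e5 : 0 ≤ c * ((c ^ 2 - s ^ 2) * (y - p.2) - 2 * s * c * (h - p.1)) :=
            mul_nonneg hc.le (by linarith)
          have e6 : 0 ≤ (c ^ 2 - s ^ 2) * (s * p.1 + c * p.2) := by positivity
          exact ⟨by linarith, by linarith, by linarith⟩
    · exact Or.inl (hBback hp)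
  refine le_trans (measure_mono hsub) (le_trans (measure_union_le _ _) ?_)
  refine le_trans (add_le_add le_rfl (measure_union_le _ _)) (le_of_eq ?_)
  rw [hback, htop, hbot, unionArea, add_assoc, ENNReal.ofReal_add (by positivity) (by positivity),
    ENNReal.ofReal_add (by positivity) (by positivity)]

end Union

/-! ### The areas of the regions that have to be empty -/

/-- The coordinates along and across the axis of `C_i`; for `σ = -1` the plane is also reflected
in the axis. -/
def frame (k : ℕ) (i : Fin k) (σ : ℝ) (v : ℝ × ℝ) : ℝ × ℝ :=
  (height k i v, σ * offset k i v)

lemma measurePreserving_frame (k : ℕ) (i : Fin k) {σ : ℝ} (hσ : σ = 1 ∨ σ = -1) :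
    MeasurePreserving (frame k i σ) := by
  have hmeas : Measurable (frame k i σ) :=
    (measurable_height k i).prodMk ((measurable_offset k i).const_mul σ)
  refine ⟨hmeas, Measure.ext fun s hs => ?_⟩
  have h : frame k i σ = planeMap (Real.cos (axisAngle k i)) (Real.sin (axisAngle k i))
      (-(σ * Real.sin (axisAngle k i))) (σ * Real.cos (axisAngle k i)) := by
    ext v
    · simp only [frame, height, planeMap_apply]; ring
    · simp only [frame, offset, planeMap_apply]; ring
  have hd : Real.cos (axisAngle k i) * (σ * Real.cos (axisAngle k i)) -
      Real.sin (axisAngle k i) * (-(σ * Real.sin (axisAngle k i))) = σ := by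
    linear_combination σ * Real.sin_sq_add_cos_sq (axisAngle k i)
  have hσ0 : σ ≠ 0 := by rcases hσ with rfl | rfl <;> norm_num
  have habs : |σ⁻¹| = 1 := by rcases hσ with rfl | rfl <;> norm_num
  rw [Measure.map_apply hmeas hs, h, volume_preimage_planeMap (by rwa [hd]), hd, habs]
  simp

lemma sin_pi_div_pos {k : ℕ} (hk : 3 ≤ k) : 0 < Real.sin (Real.pi / k) :=
  Real.sin_pos_of_pos_of_lt_pi (pi_div_pos hk)
    ((pi_div_lt_pi_div_two hk).trans (by linarith [Real.pi_pos]))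

lemma cos_pi_div_pos {k : ℕ} (hk : 3 ≤ k) : 0 < Real.cos (Real.pi / k) :=
  Real.cos_pos_of_mem_Ioo ⟨by linarith [pi_div_pos hk, Real.pi_pos], pi_div_lt_pi_div_two hk⟩

lemma sin_pi_div_lt_cos {k : ℕ} (hk : 5 ≤ k) : Real.sin (Real.pi / k) < Real.cos (Real.pi / k) := by
  have h4 : Real.pi / k < Real.pi / 4 :=
    div_lt_div_of_pos_left Real.pi_pos (by norm_num) (by exact_mod_cast (by omega : 4 < k))
  have h0 := pi_div_pos (by omega : 3 ≤ k)
  rw [← Real.sin_pi_div_two_sub]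
  exact Real.sin_lt_sin_of_lt_of_le_pi_div_two (by linarith) (by linarith) (by linarith)

/-- The inequalities that define the cone `C_i`, with the tangent cleared. -/
lemma mem_cone_iff' {k : ℕ} (hk : 3 ≤ k) (i : Fin k) (v : ℝ × ℝ) :
    v ∈ cone k i ↔ 0 < height k i v ∧
      0 ≤ Real.sin (Real.pi / k) * height k i v + Real.cos (Real.pi / k) * offset k i v ∧
      0 < Real.sin (Real.pi / k) * height k i v - Real.cos (Real.pi / k) * offset k i v := by
  have hc := cos_pi_div_pos hk
  have hsplus : Real.sin (Real.pi / k) * height k i v + Real.cos (Real.pi / k) * offset k i v =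
      Real.cos (Real.pi / k) * (Real.tan (Real.pi / k) * height k i v + offset k i v) := by
    rw [Real.tan_eq_sin_div_cos]; field_simp
  have hsminus : Real.sin (Real.pi / k) * height k i v - Real.cos (Real.pi / k) * offset k i v =
      Real.cos (Real.pi / k) * (Real.tan (Real.pi / k) * height k i v - offset k i v) := by
    rw [Real.tan_eq_sin_div_cos]; field_simp
  rw [mem_cone_iff hk, hsplus, hsminus, mul_nonneg_iff_of_pos_left hc, mul_pos_iff_of_pos_left hc,
    sub_pos, neg_le_iff_add_nonneg']

/-- For odd `k`, the reversed direction of the axis of `C_i` is the common boundary ray of two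
cones. Their axes are obtained by turning that direction by `π / k` to either side. -/
lemma exists_axisAngle_opposite {k : ℕ} (hk : Odd k) (i : Fin k) {σ : ℝ} (hσ : σ = 1 ∨ σ = -1) :
    ∃ j : Fin k, Real.cos (axisAngle k j) = -Real.cos (axisAngle k i + σ * (Real.pi / k)) ∧
      Real.sin (axisAngle k j) = -Real.sin (axisAngle k i + σ * (Real.pi / k)) := by
  obtain ⟨r, hr⟩ := hk
  have hk0 : (k : ℝ) ≠ 0 := by exact_mod_cast (by omega : k ≠ 0)
  -- The axis angle of `C_j` is `(2 * j + 1) * π / k`, so the index has to grow by `(k ± 1) / 2`.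
  obtain ⟨m, hmk, hm⟩ : ∃ m : ℕ, m ≤ k ∧ 2 * (m : ℝ) = k + σ := by
    rcases hσ with rfl | rfl
    · refine ⟨r + 1, by omega, ?_⟩
      rw [hr]; push_cast; ring
    · refine ⟨r, by omega, ?_⟩
      rw [hr]; push_cast; ring
  rcases lt_or_ge ((i : ℕ) + m) k with h | h
  · have he : axisAngle k ⟨i + m, h⟩ = axisAngle k i + σ * (Real.pi / k) + Real.pi := by
      simp only [axisAngle]
      push_cast
      field_simp
      linarith
    exact ⟨⟨i + m, h⟩, by rw [he, Real.cos_add_pi], by rw [he, Real.sin_add_pi]⟩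
  · have he : axisAngle k ⟨i + m - k, by omega⟩ =
        axisAngle k i + σ * (Real.pi / k) - Real.pi := by
      simp only [axisAngle]
      rw [Nat.cast_sub h]
      push_cast
      field_simp
      linarith
    exact ⟨⟨i + m - k, by omega⟩, by rw [he, Real.cos_sub_pi], by rw [he, Real.sin_sub_pi]⟩

/-- The cone in which a point of `C_i` sees the origin, in the coordinates of `C_i` reflected so
that the point lies to the left of the axis. -/
lemma exists_opposite_cone {k : ℕ} (hk : Odd k) (hk5 : 5 ≤ k) {i : Fin k} {v : ℝ × ℝ}
    (hv : v ∈ cone k i) :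
    ∃ (j : Fin k) (σ : ℝ), (σ = 1 ∨ σ = -1) ∧ σ * offset k i v = |offset k i v| ∧
      -v ∈ cone k j ∧ ∀ p,
        height k j p = -(Real.cos (Real.pi / k) * height k i p +
          Real.sin (Real.pi / k) * (σ * offset k i p)) ∧
        σ * offset k j p = Real.sin (Real.pi / k) * height k i p -
          Real.cos (Real.pi / k) * (σ * offset k i p) := by
  have hk3 : 3 ≤ k := by omega
  have hs := sin_pi_div_pos hk3
  have hc := cos_pi_div_pos hk3
  have hsc := sin_pi_div_lt_cos hk5
  have hC : 0 < Real.cos (Real.pi / k) ^ 2 - Real.sin (Real.pi / k) ^ 2 := by nlinarith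
  rw [mem_cone_iff' hk3] at hv
  obtain ⟨hh, hlow, hup⟩ := hv
  -- The coordinates of `C_j` are those of `C_i` turned by `π + σ * π / k`.
  have key : ∀ σ : ℝ, σ = 1 ∨ σ = -1 → ∃ j : Fin k, ∀ p,
        height k j p = -(Real.cos (Real.pi / k) * height k i p +
          Real.sin (Real.pi / k) * (σ * offset k i p)) ∧
        σ * offset k j p = Real.sin (Real.pi / k) * height k i p -
          Real.cos (Real.pi / k) * (σ * offset k i p) := by
    intro σ hσ
    obtain ⟨j, hcj, hsj⟩ := exists_axisAngle_opposite hk i hσ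
    refine ⟨j, fun p => ?_⟩
    rcases hσ with rfl | rfl
    · rw [one_mul, Real.cos_add] at hcj
      rw [one_mul, Real.sin_add] at hsj
      simp only [height, offset, hcj, hsj]
      constructor <;> ring
    · rw [neg_one_mul, Real.cos_add, Real.cos_neg, Real.sin_neg] at hcj
      rw [neg_one_mul, Real.sin_add, Real.cos_neg, Real.sin_neg] at hsj
      simp only [height, offset, hcj, hsj]
      constructor <;> ring
  have hneg : ∀ j : Fin k, height k j (-v) = -height k j v ∧ offset k j (-v) = -offset k j v := by
    intro j
    simp only [height, offset, Prod.fst_neg, Prod.snd_neg]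
    constructor <;> ring
  rcases le_or_gt 0 (offset k i v) with hy | hy
  · obtain ⟨j, hj⟩ := key 1 (Or.inl rfl)
    refine ⟨j, 1, Or.inl rfl, by rw [one_mul, abs_of_nonneg hy], ?_, hj⟩
    obtain ⟨h1, h2⟩ := hj v
    rw [mem_cone_iff' hk3, (hneg j).1, (hneg j).2]
    simp only [one_mul] at h1 h2
    rw [h1, h2]
    set s := Real.sin (Real.pi / k)
    set c := Real.cos (Real.pi / k)
    have e2 : 0 ≤ s * s * offset k i v := by positivity
    have e3 : 0 ≤ c * c * offset k i v := by positivity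
    refine ⟨by linarith [mul_pos hc hh, mul_nonneg hs.le hy], by linarith, ?_⟩
    have e4 : 0 < c * (2 * s * c * height k i v - (c ^ 2 - s ^ 2) * offset k i v) := by
      have : 0 < (c ^ 2 - s ^ 2) * (s * height k i v - c * offset k i v) := mul_pos hC hup
      have h5 : 0 < s * (c ^ 2 + s ^ 2) * height k i v := by positivity
      linarith
    have e5 := (pos_iff_pos_of_mul_pos e4).1 hc
    linarith
  · obtain ⟨j, hj⟩ := key (-1) (Or.inr rfl)
    refine ⟨j, -1, Or.inr rfl, by rw [neg_one_mul, abs_of_neg hy], ?_, hj⟩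
    obtain ⟨h1, h2⟩ := hj v
    rw [mem_cone_iff' hk3, (hneg j).1, (hneg j).2]
    simp only [neg_mul, one_mul] at h1 h2
    rw [h1, h2]
    set s := Real.sin (Real.pi / k)
    set c := Real.cos (Real.pi / k)
    have hy' : 0 < -offset k i v := by linarith
    have e2 : 0 < s * s * -offset k i v := by positivity
    have e3 : 0 < c * c * -offset k i v := by positivity
    refine ⟨by linarith [mul_pos hc hh, mul_pos hs hy'], ?_, by linarith⟩
    have e4 : 0 < c * (2 * s * c * height k i v + (c ^ 2 - s ^ 2) * offset k i v) := by
      have : 0 ≤ (c ^ 2 - s ^ 2) * (s * height k i v + c * offset k i v) := mul_nonneg hC.le hlow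
      have h5 : 0 < s * (c ^ 2 + s ^ 2) * height k i v := by positivity
      linarith
    have e5 := (pos_iff_pos_of_mul_pos e4).1 hc
    linarith

lemma measurableSet_openTriangle (s c h : ℝ) : MeasurableSet (openTriangle s c h) := by
  unfold openTriangle; measurability

lemma measurableSet_closedTriangle (s c h : ℝ) : MeasurableSet (closedTriangle s c h) := by
  unfold closedTriangle; measurability

lemma measurableSet_openBackTriangle (s c h y : ℝ) : MeasurableSet (openBackTriangle s c h y) := by
  unfold openBackTriangle; measurability

lemma measurableSet_closedBackTriangle (s c h y : ℝ) :
    MeasurableSet (closedBackTriangle s c h y) := by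
  unfold closedBackTriangle; measurability

lemma mem_region_of_frame_mem {k : ℕ} (hk : 3 ≤ k) {i : Fin k} {σ : ℝ} (hσ : σ = 1 ∨ σ = -1)
    {v p : ℝ × ℝ} (hp : frame k i σ p ∈ openTriangle (Real.sin (Real.pi / k))
      (Real.cos (Real.pi / k)) (height k i v)) : p ∈ region k i v := by
  obtain ⟨h1, h2, h3⟩ := hp
  have hs := sin_pi_div_pos hk
  simp only [frame] at h1 h2 h3
  have h4 : 0 < Real.sin (Real.pi / k) * height k i p := by linarith
  refine ⟨(mem_cone_iff' hk i p).2 ⟨(pos_iff_pos_of_mul_pos h4).1 hs, ?_⟩, h1⟩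
  rcases hσ with rfl | rfl <;> constructor <;> linarith

lemma frame_mem_of_mem_region {k : ℕ} (hk : 3 ≤ k) {i : Fin k} {σ : ℝ} (hσ : σ = 1 ∨ σ = -1)
    {v p : ℝ × ℝ} (hp : p ∈ region k i v) :
    frame k i σ p ∈ closedTriangle (Real.sin (Real.pi / k)) (Real.cos (Real.pi / k))
      (height k i v) := by
  obtain ⟨h1, h2⟩ := hp
  obtain ⟨-, h4, h5⟩ := (mem_cone_iff' hk i p).1 h1
  refine ⟨h2.le, ?_⟩
  simp only [frame]
  rcases hσ with rfl | rfl <;> constructor <;> linarith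

lemma volume_region {k : ℕ} (hk : 3 ≤ k) {i : Fin k} {v : ℝ × ℝ} (hv : v ∈ cone k i) :
    volume (region k i v) = ENNReal.ofReal (Real.tan (Real.pi / k) * height k i v ^ 2) := by
  have hs := sin_pi_div_pos hk
  have hc := cos_pi_div_pos hk
  have hh := ((mem_cone_iff' hk i v).1 hv).1.le
  rw [Real.tan_eq_sin_div_cos]
  exact volume_eq_of_between (measurePreserving_frame k i (Or.inl rfl))
    (measurableSet_openTriangle _ _ _) (measurableSet_closedTriangle _ _ _)
    (volume_openTriangle hs hc hh).ge (volume_closedTriangle hs hc hh).le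
    (fun p => mem_region_of_frame_mem hk (Or.inl rfl))
    (fun p => frame_mem_of_mem_region hk (Or.inl rfl))

/-- In the coordinates of `C_i`, reflected if necessary, the points preferred by `v` to the origin
form the second triangle of `unionArea`, up to its boundary. -/
lemma volume_mutualRegion {k : ℕ} (hk : Odd k) (hk5 : 5 ≤ k) {i : Fin k} {v : ℝ × ℝ}
    (hv : v ∈ cone k i) :
    volume (mutualRegion k i v) = ENNReal.ofReal (unionArea (Real.sin (Real.pi / k))
      (Real.cos (Real.pi / k)) (height k i v) |offset k i v|) := by
  have hk3 : 3 ≤ k := by omega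
  have hs := sin_pi_div_pos hk3
  have hc := cos_pi_div_pos hk3
  have hsc := sin_pi_div_lt_cos hk5
  have h1 := Real.sin_sq_add_cos_sq (Real.pi / k)
  obtain ⟨hh, hlow, hup⟩ := (mem_cone_iff' hk3 i v).1 hv
  have hy : Real.cos (Real.pi / k) * |offset k i v| ≤ Real.sin (Real.pi / k) * height k i v := by
    rcases abs_cases (offset k i v) with ⟨h, -⟩ | ⟨h, -⟩ <;> rw [h] <;> linarith
  obtain ⟨j, σ, hσ, hσv, hj, hcoord⟩ := exists_opposite_cone hk hk5 hv
  have hregion : ∀ p, p ∈ mutualRegion k i v ↔ p ∈ region k i v ∨ p - v ∈ region k j (-v) := by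
    intro p
    refine or_congr Iff.rfl ⟨?_, fun h => ⟨j, hj, h⟩⟩
    rintro ⟨j', hj', h⟩
    rwa [eq_of_mem_cone hj' hj] at h
  have hback : ∀ p, p - v ∈ region k j (-v) ↔
      0 < Real.cos (Real.pi / k) * (height k i v - height k i p) +
        Real.sin (Real.pi / k) * (|offset k i v| - σ * offset k i p) ∧
      (0 ≤ Real.sin (Real.pi / k) * height k j (p - v) +
          Real.cos (Real.pi / k) * offset k j (p - v) ∧
        0 < Real.sin (Real.pi / k) * height k j (p - v) -
          Real.cos (Real.pi / k) * offset k j (p - v)) ∧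
      0 < Real.cos (Real.pi / k) * height k i p +
        Real.sin (Real.pi / k) * (σ * offset k i p) := by
    intro p
    have hsub : height k j (p - v) = height k j p - height k j v := by
      simp only [height, Prod.fst_sub, Prod.snd_sub]; ring
    have hneg : height k j (-v) = -height k j v := by
      simp only [height, Prod.fst_neg, Prod.snd_neg]; ring
    have e1 : height k j (p - v) = Real.cos (Real.pi / k) * (height k i v - height k i p) +
        Real.sin (Real.pi / k) * (|offset k i v| - σ * offset k i p) := by
      rw [hsub, (hcoord p).1, (hcoord v).1, hσv]; ring
    have e2 : height k j (p - v) < height k j (-v) ↔ 0 < Real.cos (Real.pi / k) * height k i p +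
        Real.sin (Real.pi / k) * (σ * offset k i p) := by
      rw [hsub, hneg, (hcoord p).1]
      constructor <;> intro h <;> linarith
    rw [← e2, ← e1]
    simp only [region, mem_ofPred_eq, mem_cone_iff' hk3 j, and_assoc]
  have hoff : ∀ p, σ * offset k j (p - v) =
      Real.cos (Real.pi / k) * (|offset k i v| - σ * offset k i p) -
        Real.sin (Real.pi / k) * (height k i v - height k i p) := by
    intro p
    have hsub : offset k j (p - v) = offset k j p - offset k j v := by
      simp only [offset, Prod.fst_sub, Prod.snd_sub]; ring
    rw [hsub, mul_sub, (hcoord p).2, (hcoord v).2, hσv]; ring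
  have hhj : ∀ p, height k j (p - v) =
      Real.cos (Real.pi / k) * (height k i v - height k i p) +
        Real.sin (Real.pi / k) * (|offset k i v| - σ * offset k i p) := by
    intro p
    have hsub : height k j (p - v) = height k j p - height k j v := by
      simp only [height, Prod.fst_sub, Prod.snd_sub]; ring
    rw [hsub, (hcoord p).1, (hcoord v).1, hσv]; ring
  set s := Real.sin (Real.pi / k)
  set c := Real.cos (Real.pi / k)
  refine volume_eq_of_between (measurePreserving_frame k i hσ)
    ((measurableSet_openTriangle s c _).union (measurableSet_openBackTriangle s c _ _))
    ((measurableSet_closedTriangle s c _).union (measurableSet_closedBackTriangle s c _ _))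
    (unionArea_le_volume hs hsc h1 hh.le (abs_nonneg _) hy)
    (volume_le_unionArea hs hsc h1 hh.le (abs_nonneg _) hy) ?_ ?_
  · rintro p (hp | ⟨e1, e2, e3⟩)
    · exact (hregion p).2 (Or.inl (mem_region_of_frame_mem hk3 hσ hp))
    · refine (hregion p).2 (Or.inr ((hback p).2 ?_))
      have e4 := hoff p
      rw [hhj p]
      simp only [frame] at e1 e2 e3
      have hA : 0 < height k i v - height k i p := by
        have : 0 < (c ^ 2 - s ^ 2) * (|offset k i v| - σ * offset k i p) :=
          mul_pos (by nlinarith) e1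
        have : 0 < 2 * s * c * (height k i v - height k i p) := by linarith
        exact (pos_iff_pos_of_mul_pos this).1 (by positivity)
      have hBpos : 0 < (s ^ 2 + c ^ 2) * (|offset k i v| - σ * offset k i p) := by positivity
      refine ⟨by positivity, ?_, e3⟩
      -- The half-open cone is symmetric up to its boundary: the sign of the offset is immaterial.
      rcases hσ with rfl | rfl
      · rw [one_mul] at e4
        rw [e4]
        constructor <;> linarith
      · have e4' : offset k j (p - v) = -(c * (|offset k i v| - -1 * offset k i p) -
            s * (height k i v - height k i p)) := by linarith
        rw [e4']
        constructor <;> linarith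
  · intro p hp
    rcases (hregion p).1 hp with hp | hp
    · exact Or.inl (frame_mem_of_mem_region hk3 hσ hp)
    · right
      obtain ⟨e1, ⟨e2, e3⟩, e5⟩ := (hback p).1 hp
      have e4 := hoff p
      rw [hhj p] at e2 e3
      have hboth : 0 ≤ (s ^ 2 + c ^ 2) * (|offset k i v| - σ * offset k i p) ∧
          0 ≤ 2 * s * c * (height k i v - height k i p) -
            (c ^ 2 - s ^ 2) * (|offset k i v| - σ * offset k i p) := by
        rcases hσ with rfl | rfl
        · rw [one_mul] at e4
          rw [e4] at e2 e3
          constructor <;> linarith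
        · have e4' : offset k j (p - v) = -(c * (|offset k i v| - -1 * offset k i p) -
              s * (height k i v - height k i p)) := by linarith
          rw [e4'] at e2 e3
          constructor <;> linarith
      rw [h1, one_mul] at hboth
      exact ⟨hboth.1, hboth.2, e5.le⟩

/-! ### Integration over a cone -/

/-- The sector of the points to the right of the origin with slopes in `[-τ, τ)`. -/
def sector (τ : ℝ) : Set (ℝ × ℝ) :=
  {q | 0 < q.1 ∧ -(τ * q.1) ≤ q.2 ∧ q.2 < τ * q.1}

lemma measurableSet_sector (τ : ℝ) : MeasurableSet (sector τ) := by
  unfold sector; measurability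

lemma cone_eq_preimage_sector {k : ℕ} (hk : 3 ≤ k) (i : Fin k) :
    cone k i = frame k i 1 ⁻¹' sector (Real.tan (Real.pi / k)) := by
  ext v
  rw [mem_cone_iff hk, mem_preimage, frame, one_mul]
  rfl

lemma lintegral_mul_exp_neg_sq {b : ℝ} (hb : 0 < b) :
    ∫⁻ x in Ioi (0 : ℝ), ENNReal.ofReal (x * Real.exp (-(x ^ 2 * b))) =
      ENNReal.ofReal (1 / (2 * b)) := by
  have hderiv : ∀ x ∈ Ici (0 : ℝ), HasDerivAt (fun x => -(Real.exp (-(x ^ 2 * b)) / (2 * b)))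
      (x * Real.exp (-(x ^ 2 * b))) x := by
    intro x _
    have h := (((((hasDerivAt_id x).pow 2).mul_const b).neg.exp).div_const (2 * b)).neg
    refine h.congr_deriv ?_
    simp only [id]
    field_simp
    simp only [Pi.neg_apply, Pi.pow_apply, id, Nat.cast_ofNat, Nat.add_one_sub_one, pow_one]
    ring_nf
  have hpos : ∀ x ∈ Ioi (0 : ℝ), 0 ≤ x * Real.exp (-(x ^ 2 * b)) := fun x hx =>
    mul_nonneg (mem_Ioi.1 hx).le (Real.exp_pos _).le
  have hlim : Filter.Tendsto (fun x : ℝ => -(Real.exp (-(x ^ 2 * b)) / (2 * b))) Filter.atTop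
      (nhds 0) := by
    have h1 : Filter.Tendsto (fun x : ℝ => x ^ 2 * b) Filter.atTop Filter.atTop :=
      (Filter.tendsto_pow_atTop two_ne_zero).atTop_mul_const hb
    simpa using ((Real.tendsto_exp_neg_atTop_nhds_zero.comp h1).div_const (2 * b)).neg
  rw [← ofReal_integral_eq_lintegral_ofReal
    (integrableOn_Ioi_deriv_of_nonneg' hderiv hpos hlim)
    ((ae_restrict_iff' measurableSet_Ioi).2 (ae_of_all _ hpos)),
    integral_Ioi_of_hasDerivAt_of_nonneg' hderiv hpos hlim]
  simp

/-- The Gaussian-type integral over a sector, in the coordinates `x` and `t = y / x`. -/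
lemma lintegral_sector {τ : ℝ} {Q : ℝ → ℝ} (hQ : Measurable Q)
    (hpos : ∀ t ∈ Ico (-τ) τ, 0 < Q t) :
    ∫⁻ q in sector τ, ENNReal.ofReal (Real.exp (-(q.1 ^ 2 * Q (q.2 / q.1)))) =
      ∫⁻ t in Ico (-τ) τ, ENNReal.ofReal (1 / (2 * Q t)) := by
  have hmeas : Measurable fun q : ℝ × ℝ =>
      ENNReal.ofReal (Real.exp (-(q.1 ^ 2 * Q (q.2 / q.1)))) := by fun_prop
  rw [← lintegral_indicator (measurableSet_sector τ), Measure.volume_eq_prod,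
    lintegral_prod _ (hmeas.indicator (measurableSet_sector τ)).aemeasurable]
  have hinner : ∀ x : ℝ, ∫⁻ y, (sector τ).indicator (fun q : ℝ × ℝ =>
      ENNReal.ofReal (Real.exp (-(q.1 ^ 2 * Q (q.2 / q.1))))) (x, y) =
      (Ioi (0 : ℝ)).indicator (fun x => ∫⁻ t in Ico (-τ) τ,
        ENNReal.ofReal (x * Real.exp (-(x ^ 2 * Q t)))) x := by
    intro x
    by_cases hx : x ∈ Ioi (0 : ℝ)
    swap
    · have h : ∀ y, (sector τ).indicator (fun q : ℝ × ℝ =>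
          ENNReal.ofReal (Real.exp (-(q.1 ^ 2 * Q (q.2 / q.1))))) (x, y) = 0 :=
        fun y => indicator_of_notMem (fun hq => hx hq.1) _
      simp [h, indicator_of_notMem hx]
    rw [indicator_of_mem hx]
    have hx0 : 0 < x := hx
    have h : ∀ y, (sector τ).indicator (fun q : ℝ × ℝ =>
        ENNReal.ofReal (Real.exp (-(q.1 ^ 2 * Q (q.2 / q.1))))) (x, y) =
        (Ico (x * -τ) (x * τ)).indicator (fun y =>
          ENNReal.ofReal (Real.exp (-(x ^ 2 * Q (y / x))))) y := by
      intro y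
      have hiff : (x, y) ∈ sector τ ↔ y ∈ Ico (x * -τ) (x * τ) := by
        simp only [sector, mem_ofPred_eq, mem_Ico, hx0, true_and, mul_neg, mul_comm]
      by_cases hy : y ∈ Ico (x * -τ) (x * τ)
      · rw [indicator_of_mem hy, indicator_of_mem (hiff.2 hy)]
      · rw [indicator_of_notMem hy, indicator_of_notMem (fun h => hy (hiff.1 h))]
    simp_rw [h]
    have himage : Ico (x * -τ) (x * τ) = (fun t => x * t) '' Ico (-τ) τ := by
      rw [image_mul_left_Ico hx0]
    rw [lintegral_indicator measurableSet_Ico, himage,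
      lintegral_image_eq_lintegral_abs_deriv_mul measurableSet_Ico
        (f := fun t => x * t) (f' := fun _ => x * 1)
        (fun t _ => ((hasDerivAt_id' t).const_mul x).hasDerivWithinAt)
        (fun t _ t' _ htt' => mul_left_cancel₀ hx0.ne' htt')]
    refine lintegral_congr fun t => ?_
    rw [mul_one, abs_of_pos hx0, ← ENNReal.ofReal_mul hx0.le, mul_div_cancel_left₀ _ hx0.ne']
  simp_rw [hinner]
  rw [lintegral_indicator measurableSet_Ioi, lintegral_lintegral_swap]
  · refine setLIntegral_congr_fun measurableSet_Ico fun t ht => ?_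
    exact lintegral_mul_exp_neg_sq (hpos t ht)
  · refine Measurable.aemeasurable ?_
    simp only [Function.uncurry_def]
    fun_prop

/-- The integral over a cone of `exp (-A)` for a function `A` that is homogeneous of degree two,
with values `Q` on the line at height `1`. -/
lemma lintegral_cone {k : ℕ} (hk : 3 ≤ k) (i : Fin k) {Q : ℝ → ℝ} (hQ : Measurable Q)
    (hpos : ∀ t ∈ Ico (-Real.tan (Real.pi / k)) (Real.tan (Real.pi / k)), 0 < Q t)
    {A : ℝ × ℝ → ℝ}
    (hA : ∀ v ∈ cone k i, A v = height k i v ^ 2 * Q (offset k i v / height k i v)) :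
    ∫⁻ v in cone k i, ENNReal.ofReal (Real.exp (-A v)) =
      ∫⁻ t in Ico (-Real.tan (Real.pi / k)) (Real.tan (Real.pi / k)),
        ENNReal.ofReal (1 / (2 * Q t)) := by
  have hmeas : Measurable fun q : ℝ × ℝ =>
      ENNReal.ofReal (Real.exp (-(q.1 ^ 2 * Q (q.2 / q.1)))) := by fun_prop
  rw [← lintegral_sector hQ hpos, ← (measurePreserving_frame k i
    (Or.inl rfl)).setLIntegral_comp_preimage (measurableSet_sector _) hmeas,
    ← cone_eq_preimage_sector hk]
  refine setLIntegral_congr_fun (measurableSet_cone hk i) fun v hv => ?_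
  simp only [frame, one_mul, hA v hv]

/-- Almost every vertex creates exactly one edge in its `i`-th cone. -/
lemma lintegral_exp_neg_volume_region {k : ℕ} (hk : 3 ≤ k) (i : Fin k) :
    ∫⁻ v in cone k i, ENNReal.ofReal (Real.exp (-(volume (region k i v)).toReal)) = 1 := by
  have hs := sin_pi_div_pos hk
  have hc := cos_pi_div_pos hk
  have hτ : 0 < Real.tan (Real.pi / k) := by rw [Real.tan_eq_sin_div_cos]; positivity
  rw [lintegral_cone hk i (Q := fun _ => Real.tan (Real.pi / k)) measurable_const
    (fun _ _ => hτ)]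
  · rw [setLIntegral_const, Real.volume_Ico, ← ENNReal.ofReal_mul (by positivity)]
    rw [← ENNReal.ofReal_one]
    congr 1
    field_simp
    ring
  · intro v hv
    rw [volume_region hk hv, ENNReal.toReal_ofReal (by positivity)]
    ring

lemma unionArea_homogeneous (s c y : ℝ) {h : ℝ} (hh : 0 < h) :
    unionArea s c h y = h ^ 2 * unionArea s c 1 (y / h) := by
  simp only [unionArea]
  field_simp

lemma unionArea_pos {s c h y : ℝ} (hs : 0 < s) (hsc : s < c) (hh : 0 < h) (hy : 0 ≤ y) :
    0 < unionArea s c h y := by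
  have hc : 0 < c := hs.trans hsc
  have hC : 0 < c ^ 2 - s ^ 2 := by nlinarith
  have hm : 0 < 3 * c ^ 2 - s ^ 2 := by nlinarith
  unfold unionArea
  positivity

lemma continuous_unionArea (s c : ℝ) : Continuous (unionArea s c 1) := by
  unfold unionArea
  fun_prop

/-- The number of mutual edges per unit area, as an integral over the slope of the edge relative to
the axis of its cone. The slopes of either sign contribute equally. -/
lemma lintegral_exp_neg_volume_mutualRegion {k : ℕ} (hk : Odd k) (hk5 : 5 ≤ k) (i : Fin k) :
    ∫⁻ v in cone k i, ENNReal.ofReal (Real.exp (-(volume (mutualRegion k i v)).toReal)) =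
      ENNReal.ofReal (∫ t in (0 : ℝ)..Real.tan (Real.pi / k),
        1 / unionArea (Real.sin (Real.pi / k)) (Real.cos (Real.pi / k)) 1 t) := by
  have hk3 : 3 ≤ k := by omega
  have hs := sin_pi_div_pos hk3
  have hc := cos_pi_div_pos hk3
  have hsc := sin_pi_div_lt_cos hk5
  have hτ : 0 < Real.tan (Real.pi / k) := by rw [Real.tan_eq_sin_div_cos]; positivity
  have hcont := continuous_unionArea (Real.sin (Real.pi / k)) (Real.cos (Real.pi / k))
  have hpos : ∀ t, 0 < unionArea (Real.sin (Real.pi / k)) (Real.cos (Real.pi / k)) 1 |t| :=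
    fun t => unionArea_pos hs hsc one_pos (abs_nonneg t)
  rw [lintegral_cone hk3 i
    (Q := fun t => unionArea (Real.sin (Real.pi / k)) (Real.cos (Real.pi / k)) 1 |t|)
    (hcont.comp continuous_abs).measurable (fun t _ => hpos t)]
  swap
  · intro v hv
    have hh := ((mem_cone_iff' hk3 i v).1 hv).1
    rw [volume_mutualRegion hk hk5 hv, ENNReal.toReal_ofReal
      (unionArea_pos hs hsc hh (abs_nonneg _)).le, unionArea_homogeneous _ _ _ hh, abs_div,
      abs_of_pos hh]
  set τ := Real.tan (Real.pi / k)
  set q := unionArea (Real.sin (Real.pi / k)) (Real.cos (Real.pi / k)) 1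
  have hcont' : Continuous fun t => 1 / (2 * q |t|) :=
    continuous_const.div₀ (continuous_const.mul (hcont.comp continuous_abs))
      fun t => (mul_pos two_pos (hpos t)).ne'
  rw [← ofReal_integral_eq_lintegral_ofReal
    (hcont'.continuousOn.integrableOn_Icc.mono_set Ico_subset_Icc_self)
    (ae_of_all _ fun t => by have := hpos t; positivity), integral_Ico_eq_integral_Ioc,
    ← intervalIntegral.integral_of_le (by linarith)]
  congr 1
  have hhalf : ∫ t in (0 : ℝ)..τ, 1 / (2 * q |t|) = (∫ t in (0 : ℝ)..τ, 1 / q t) / 2 := by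
    rw [← intervalIntegral.integral_div]
    refine intervalIntegral.integral_congr fun t ht => ?_
    rw [uIcc_of_le hτ.le] at ht
    simp only [abs_of_nonneg ht.1]
    ring
  have hneg : ∫ t in (-τ)..0, 1 / (2 * q |t|) = ∫ t in (0 : ℝ)..τ, 1 / (2 * q |t|) := by
    have h := intervalIntegral.integral_comp_neg (a := 0) (b := τ) fun t => 1 / (2 * q |t|)
    simp only [abs_neg, neg_zero] at h
    exact h.symm
  rw [← intervalIntegral.integral_add_adjacent_intervals (b := 0)
    (hcont'.intervalIntegrable _ _) (hcont'.intervalIntegrable _ _), hneg, hhalf, add_halves]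

/-- The expected number of edges is the area of `W`, and that of mutual edges is the area of `W`
times the integral. -/
theorem mutualEdgeProb_eq_integral {k : ℕ} (hk : Odd k) (hk5 : 5 ≤ k)
    {Ω : Type*} [MeasurableSpace Ω] {P : Measure Ω} [IsProbabilityMeasure P]
    {N : Ω → Set (ℝ × ℝ)} (hN : IsUnitPoissonProcess P N)
    {W : Set (ℝ × ℝ)} (hW : MeasurableSet W) (hW0 : volume W ≠ 0) (hWfin : volume W ≠ ∞)
    (i : Fin k) :
    mutualEdgeProb P N k W i = ∫ t in (0 : ℝ)..Real.tan (Real.pi / k),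
      1 / unionArea (Real.sin (Real.pi / k)) (Real.cos (Real.pi / k)) 1 t := by
  have hk3 : 3 ≤ k := by omega
  have hs := sin_pi_div_pos hk3
  have hc := cos_pi_div_pos hk3
  have hedges : ∫⁻ ω, ((edges k (N ω) W i).encard : ℝ≥0∞) ∂P = volume W := by
    have h := hN.lintegral_encard_pairs hW (measurableSet_cone hk3 i) (measurableSet_region hk3 i)
      (zero_notMem_cone k i) (zero_notMem_region k i) (self_notMem_region k i)
      (fun v hv => by rw [volume_region hk3 hv]; exact ENNReal.ofReal_ne_top)
    rw [lintegral_exp_neg_volume_region hk3, mul_one] at h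
    rw [← h]
    simp only [edges, chooses_iff]
  have hcone : ∀ v, (v ∈ cone k i ∧ ∃ j, -v ∈ cone k j) ↔ v ∈ cone k i := by
    refine fun v => ⟨fun h => h.1, fun h => ⟨h, ?_⟩⟩
    obtain ⟨j, -, -, -, hj, -⟩ := exists_opposite_cone hk hk5 h
    exact ⟨j, hj⟩
  have hmutual : ∫⁻ ω, ((mutualEdges k (N ω) W i).encard : ℝ≥0∞) ∂P =
      volume W * ENNReal.ofReal (∫ t in (0 : ℝ)..Real.tan (Real.pi / k),
        1 / unionArea (Real.sin (Real.pi / k)) (Real.cos (Real.pi / k)) 1 t) := by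
    have h := hN.lintegral_encard_pairs hW (measurableSet_cone hk3 i)
      (measurableSet_mutualRegion hk3 i)
      (zero_notMem_cone k i) (zero_notMem_mutualRegion k i) (self_notMem_mutualRegion k i)
      (fun v hv => by rw [volume_mutualRegion hk hk5 hv]; exact ENNReal.ofReal_ne_top)
    rw [lintegral_exp_neg_volume_mutualRegion hk hk5] at h
    rw [← h]
    refine lintegral_congr fun ω => ?_
    congr 2
    ext e
    rw [mem_ofPred_eq, mutualEdges, mem_ofPred_eq, edges, mem_ofPred_eq, and_assoc,
      chooses_and_exists_chooses_iff, hcone]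
  have hτ : 0 ≤ Real.tan (Real.pi / k) := by rw [Real.tan_eq_sin_div_cos]; positivity
  rw [mutualEdgeProb, hedges, hmutual, mul_comm, ENNReal.mul_div_cancel_right hW0 hWfin,
    ENNReal.toReal_ofReal]
  refine intervalIntegral.integral_nonneg hτ fun t ht => ?_
  have := unionArea_pos hs (sin_pi_div_lt_cos hk5) one_pos ht.1
  positivity

/-! ### The closed form -/

/-- The integral of the reciprocal of a quadratic polynomial without real zeros. -/
lemma integral_one_div_quadratic {a b e D : ℝ} (ha : 0 < a) (hD : 0 < D)
    (hDe : D = a * e - b ^ 2) (τ : ℝ) :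
    ∫ t in (0 : ℝ)..τ, 1 / (a * t ^ 2 + 2 * b * t + e) =
      1 / √D * (Real.arctan ((a * τ + b) / √D) - Real.arctan (b / √D)) := by
  have hS2 : √D ^ 2 = D := Real.sq_sqrt hD.le
  have hsq : ∀ t, a * (a * t ^ 2 + 2 * b * t + e) = (a * t + b) ^ 2 + D := fun t => by
    rw [hDe]; ring
  have hq : ∀ t, 0 < a * t ^ 2 + 2 * b * t + e := fun t =>
    (pos_iff_pos_of_mul_pos (by rw [hsq]; positivity)).1 ha
  have hderiv : ∀ t ∈ uIcc 0 τ, HasDerivAt (fun t => 1 / √D * Real.arctan ((a * t + b) / √D))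
      (1 / (a * t ^ 2 + 2 * b * t + e)) t := by
    intro t _
    have h := ((((hasDerivAt_id t).const_mul a).add_const b).div_const (√D)).arctan.const_mul
      (1 / √D)
    refine h.congr_deriv ?_
    have h2 : 1 + ((a * id t + b) / √D) ^ 2 = a * (a * t ^ 2 + 2 * b * t + e) / √D ^ 2 := by
      rw [hsq, div_pow, hS2, id]; field_simp
      ring
    rw [h2]
    field_simp
  rw [intervalIntegral.integral_eq_sub_of_hasDerivAt hderiv]
  · rw [mul_zero, zero_add, mul_sub]
  · refine Continuous.intervalIntegrable ?_ _ _
    exact continuous_const.div₀ (by fun_prop) fun t => (hq t).ne'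

/-- A quarter of the negated discriminant of the polynomial `unionArea s c 1`, for
`s ^ 2 + c ^ 2 = 1`. The polynomial is a combination of the squares of `c + s * t`, `s - c * t` and
`s + c * t`, and each of the three terms belongs to two of these squares. -/
def unionDisc (s c : ℝ) : ℝ :=
  1 / (2 * c ^ 2) + (c ^ 2 - s ^ 2) ^ 3 / (2 * c ^ 2 * (3 * c ^ 2 - s ^ 2)) +
    (c ^ 2 - s ^ 2) / (3 * c ^ 2 - s ^ 2)

lemma unionDisc_pos {s c : ℝ} (hs : 0 < s) (hsc : s < c) : 0 < unionDisc s c := by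
  have hC : 0 < c ^ 2 - s ^ 2 := by nlinarith
  have hm : 0 < 3 * c ^ 2 - s ^ 2 := by nlinarith
  unfold unionDisc
  positivity

lemma integral_one_div_unionArea {s c : ℝ} (hs : 0 < s) (hsc : s < c) (h1 : s ^ 2 + c ^ 2 = 1) :
    ∫ t in (0 : ℝ)..(s / c), 1 / unionArea s c 1 t = 1 / √(unionDisc s c) *
      (Real.arctan ((c ^ 2 - s ^ 2) ^ 2 / ((3 * c ^ 2 - s ^ 2) * √(unionDisc s c))) +
        Real.arctan ((2 * (c ^ 2 - s ^ 2) + (2 * s * c) ^ 2) /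
          (2 * c ^ 2 * (3 * c ^ 2 - s ^ 2) * √(unionDisc s c)))) := by
  have hc : 0 < c := hs.trans hsc
  have hC : 0 < c ^ 2 - s ^ 2 := by nlinarith
  have hm : 0 < 3 * c ^ 2 - s ^ 2 := by nlinarith
  have hD := unionDisc_pos hs hsc
  obtain ⟨M, hM⟩ : ∃ M, M = 3 * c ^ 2 - s ^ 2 := ⟨_, rfl⟩
  have hM0 : 0 < M := hM ▸ hm
  obtain ⟨a, ha⟩ : ∃ a, a = s / c * s ^ 2 + c ^ 2 / (2 * (s * c)) +
    (c ^ 2 - s ^ 2) * c ^ 2 / (2 * (s * c * (3 * c ^ 2 - s ^ 2))) := ⟨_, rfl⟩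
  obtain ⟨e, he⟩ : ∃ e, e = s / c * c ^ 2 + s ^ 2 / (2 * (s * c)) +
    (c ^ 2 - s ^ 2) * s ^ 2 / (2 * (s * c * (3 * c ^ 2 - s ^ 2))) := ⟨_, rfl⟩
  obtain ⟨b, hb⟩ : ∃ b, b = -((c ^ 2 - s ^ 2) ^ 2 / (3 * c ^ 2 - s ^ 2)) := ⟨_, rfl⟩
  have ha0 : 0 < a := by rw [ha]; positivity
  -- Collecting the terms in `t` gives the second form of `b`; it equals the first one, which is
  -- visibly negative, because `s ^ 2 + c ^ 2 = 1`.
  have hb' : b = s ^ 2 - 1 / 2 + (c ^ 2 - s ^ 2) / (2 * (3 * c ^ 2 - s ^ 2)) := by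
    rw [hb, ← hM]
    field_simp
    rw [hM]
    linear_combination (-2 * c ^ 2) * h1
  have hquad : ∀ t, unionArea s c 1 t = a * t ^ 2 + 2 * b * t + e := by
    intro t
    rw [hb', ha, he, unionArea]
    field_simp
    ring
  have hdisc : unionDisc s c = a * e - b ^ 2 := by
    -- Lagrange's identity for the three squares.
    have h : a * e - b ^ 2 = (s ^ 2 + c ^ 2) ^ 2 / (2 * c ^ 2) +
        (c ^ 2 - s ^ 2) ^ 3 / (2 * c ^ 2 * (3 * c ^ 2 - s ^ 2)) +
        (c ^ 2 - s ^ 2) / (3 * c ^ 2 - s ^ 2) := by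
      rw [hb', ha, he]
      field_simp
      ring
    rw [h, h1, one_pow, unionDisc]
  have hend : a * (s / c) + b =
      (2 * (c ^ 2 - s ^ 2) + (2 * s * c) ^ 2) / (2 * c ^ 2 * (3 * c ^ 2 - s ^ 2)) := by
    have h : a * (s / c) + b = s ^ 2 * (s ^ 2 + c ^ 2) / c ^ 2 +
        (c ^ 2 - s ^ 2) / (3 * c ^ 2 - s ^ 2) := by
      rw [hb', ha]
      field_simp
      ring
    rw [h, h1, ← hM]
    field_simp
    rw [hM]
    linear_combination (c ^ 2 - s ^ 2) * h1
  simp_rw [hquad]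
  rw [integral_one_div_quadratic ha0 hD hdisc, hend, hb, neg_div, Real.arctan_neg, sub_neg_eq_add,
    div_div, div_div, add_comm]

lemma cos_five_mul (x : ℝ) :
    Real.cos (5 * x) = 16 * Real.cos x ^ 5 - 20 * Real.cos x ^ 3 + 5 * Real.cos x := by
  have h := Real.cos_add_cos (5 * x) x
  rw [show (5 * x + x) / 2 = 3 * x by ring, show (5 * x - x) / 2 = 2 * x by ring,
    Real.cos_three_mul, Real.cos_two_mul] at h
  linear_combination h

lemma cos_seven_mul (x : ℝ) :
    Real.cos (7 * x) = 64 * Real.cos x ^ 7 - 112 * Real.cos x ^ 5 + 56 * Real.cos x ^ 3 -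
      7 * Real.cos x := by
  have h := Real.cos_add_cos (7 * x) (3 * x)
  rw [show (7 * x + 3 * x) / 2 = 5 * x by ring, show (7 * x - 3 * x) / 2 = 2 * x by ring,
    Real.cos_three_mul, Real.cos_two_mul, cos_five_mul] at h
  linear_combination h

lemma sin_four_mul (x : ℝ) :
    Real.sin (4 * x) = Real.sin x * (8 * Real.cos x ^ 3 - 4 * Real.cos x) := by
  rw [show 4 * x = 2 * (2 * x) by ring, Real.sin_two_mul, Real.sin_two_mul, Real.cos_two_mul]
  ring

lemma sin_three_mul' (x : ℝ) : Real.sin (3 * x) = Real.sin x * (4 * Real.cos x ^ 2 - 1) := by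
  rw [Real.sin_three_mul]
  linear_combination (-4 * Real.sin x) * Real.sin_sq_add_cos_sq x

lemma sin_five_mul (x : ℝ) :
    Real.sin (5 * x) = Real.sin x * (16 * Real.cos x ^ 4 - 12 * Real.cos x ^ 2 + 1) := by
  have h := Real.sin_add_sin (5 * x) (3 * x)
  rw [show (5 * x + 3 * x) / 2 = 4 * x by ring, show (5 * x - 3 * x) / 2 = x by ring,
    sin_four_mul, sin_three_mul'] at h
  linear_combination h

section ClosedForm

variable {k : ℕ}

lemma cos_two_pi_div_pos (hk : 5 ≤ k) : 0 < Real.cos (2 * Real.pi / k) := by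
  have hs := sin_pi_div_pos (by omega : 3 ≤ k)
  have hsc := sin_pi_div_lt_cos hk
  rw [mul_div_assoc, Real.cos_two_mul']
  nlinarith

lemma oddGamma_eq (k : ℕ) : oddGamma k =
    4 * (1 + 2 * Real.cos (2 * Real.pi / k) + Real.cos (2 * Real.pi / k) ^ 3) := by
  rw [oddGamma, show 6 * Real.pi / k = 3 * (2 * Real.pi / k) by ring, Real.cos_three_mul]
  ring

lemma oddGamma_pos (hk : 5 ≤ k) : 0 < oddGamma k := by
  have := cos_two_pi_div_pos hk
  rw [oddGamma_eq]
  positivity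

lemma oddBeta_eq (k : ℕ) : oddBeta k = √(4 * Real.sin (Real.pi / k) * Real.cos (Real.pi / k) *
    (3 * Real.cos (Real.pi / k) ^ 2 - Real.sin (Real.pi / k) ^ 2) * oddGamma k) := by
  have hS : Real.sin (2 * Real.pi / k) = 2 * Real.sin (Real.pi / k) * Real.cos (Real.pi / k) := by
    rw [mul_div_assoc, Real.sin_two_mul]
  have hM : 3 * Real.cos (Real.pi / k) ^ 2 - Real.sin (Real.pi / k) ^ 2 =
      1 + 2 * Real.cos (2 * Real.pi / k) := by
    rw [mul_div_assoc, Real.cos_two_mul']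
    linear_combination Real.sin_sq_add_cos_sq (Real.pi / k)
  rw [oddBeta, hM, oddGamma_eq, show 4 * Real.pi / k = 2 * (2 * Real.pi / k) by ring,
    show 6 * Real.pi / k = 3 * (2 * Real.pi / k) by ring,
    show 8 * Real.pi / k = 4 * (2 * Real.pi / k) by ring,
    show 10 * Real.pi / k = 5 * (2 * Real.pi / k) by ring, Real.sin_two_mul, sin_three_mul',
    sin_four_mul, sin_five_mul, hS]
  congr 1
  ring

lemma oddAlpha_eq (hk : 5 ≤ k) : oddAlpha k = √(16 * Real.cos (Real.pi / k) ^ 3 *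
    (3 * Real.cos (Real.pi / k) ^ 2 - Real.sin (Real.pi / k) ^ 2) *
    unionDisc (Real.sin (Real.pi / k)) (Real.cos (Real.pi / k)) /
      (Real.sin (Real.pi / k) * oddGamma k)) := by
  have hs := sin_pi_div_pos (by omega : 3 ≤ k)
  have hc := cos_pi_div_pos (by omega : 3 ≤ k)
  have hsc := sin_pi_div_lt_cos hk
  have hm : 0 < 3 * Real.cos (Real.pi / k) ^ 2 - Real.sin (Real.pi / k) ^ 2 := by nlinarith
  have hnum : 27 * Real.cos (Real.pi / k) + 17 * Real.cos (3 * Real.pi / k)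
      + 3 * Real.cos (5 * Real.pi / k) + Real.cos (7 * Real.pi / k) =
      16 * Real.cos (Real.pi / k) ^ 3 *
        (3 * Real.cos (Real.pi / k) ^ 2 - Real.sin (Real.pi / k) ^ 2) *
        unionDisc (Real.sin (Real.pi / k)) (Real.cos (Real.pi / k)) := by
    have hclear : 16 * Real.cos (Real.pi / k) ^ 3 *
        (3 * Real.cos (Real.pi / k) ^ 2 - Real.sin (Real.pi / k) ^ 2) *
        unionDisc (Real.sin (Real.pi / k)) (Real.cos (Real.pi / k)) =
        8 * Real.cos (Real.pi / k) *
          ((3 * Real.cos (Real.pi / k) ^ 2 - Real.sin (Real.pi / k) ^ 2) +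
          (Real.cos (Real.pi / k) ^ 2 - Real.sin (Real.pi / k) ^ 2) ^ 3 +
          2 * Real.cos (Real.pi / k) ^ 2 *
            (Real.cos (Real.pi / k) ^ 2 - Real.sin (Real.pi / k) ^ 2)) := by
      obtain ⟨M, hM⟩ : ∃ M, M = 3 * Real.cos (Real.pi / k) ^ 2 - Real.sin (Real.pi / k) ^ 2 :=
        ⟨_, rfl⟩
      have hM0 : 0 < M := hM ▸ hm
      rw [unionDisc, ← hM]
      field_simp
      ring
    rw [hclear, Real.sin_sq, show 3 * Real.pi / k = 3 * (Real.pi / k) by ring,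
      show 5 * Real.pi / k = 5 * (Real.pi / k) by ring,
      show 7 * Real.pi / k = 7 * (Real.pi / k) by ring, Real.cos_three_mul, cos_five_mul,
      cos_seven_mul]
    ring
  rw [oddAlpha, hnum]
  congr 1
  field_simp

/-- The product through which `α` and `β` enter the arguments of the arctangents. -/
lemma oddAlpha_mul_oddBeta (hk : 5 ≤ k) : oddAlpha k * oddBeta k =
    8 * Real.cos (Real.pi / k) ^ 2 *
      (3 * Real.cos (Real.pi / k) ^ 2 - Real.sin (Real.pi / k) ^ 2) *
      √(unionDisc (Real.sin (Real.pi / k)) (Real.cos (Real.pi / k))) := by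
  have hs := sin_pi_div_pos (by omega : 3 ≤ k)
  have hc := cos_pi_div_pos (by omega : 3 ≤ k)
  have hsc := sin_pi_div_lt_cos hk
  have hγ := oddGamma_pos hk
  have hm : 0 < 3 * Real.cos (Real.pi / k) ^ 2 - Real.sin (Real.pi / k) ^ 2 := by nlinarith
  have hD := unionDisc_pos hs hsc
  rw [oddAlpha_eq hk, oddBeta_eq, ← Real.sqrt_mul (by positivity)]
  rw [Real.sqrt_eq_iff_mul_self_eq (by positivity) (by positivity)]
  field_simp
  rw [Real.sq_sqrt hD.le]
  ring

end ClosedForm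

end ThetaGraph

end

theorem mainTheorem2 (k : ℕ) (hk : Odd k) (hk5 : 5 ≤ k)
    {Ω : Type*} [MeasurableSpace Ω] (P : Measure Ω) [IsProbabilityMeasure P]
    (N : Ω → Set (ℝ × ℝ)) (hN : ThetaGraph.IsUnitPoissonProcess P N)
    (W : Set (ℝ × ℝ)) (hW : MeasurableSet W) (hW0 : volume W ≠ 0) (hWfin : volume W ≠ ∞)
    (i : Fin k) :
    ThetaGraph.mutualEdgeProb P N k W i =
      2 * (Real.arctan (2 * (Real.cos (Real.pi / k) + Real.cos (3 * Real.pi / k)) ^ 2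
              / (ThetaGraph.oddAlpha k * ThetaGraph.oddBeta k))
          + Real.arctan (4 * (2 * Real.cos (2 * Real.pi / k) + Real.sin (2 * Real.pi / k) ^ 2)
              / (ThetaGraph.oddAlpha k * ThetaGraph.oddBeta k)))
        * Real.cot (Real.pi / k) * ThetaGraph.oddBeta k
        / (ThetaGraph.oddGamma k * ThetaGraph.oddAlpha k) := by
  have hk3 : 3 ≤ k := by omega
  have hs := ThetaGraph.sin_pi_div_pos hk3
  have hc := ThetaGraph.cos_pi_div_pos hk3
  have hsc := ThetaGraph.sin_pi_div_lt_cos hk5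
  have h1 := Real.sin_sq_add_cos_sq (Real.pi / k)
  have hm : 0 < 3 * Real.cos (Real.pi / k) ^ 2 - Real.sin (Real.pi / k) ^ 2 := by nlinarith
  have hD := ThetaGraph.unionDisc_pos hs hsc
  have hγ := ThetaGraph.oddGamma_pos hk5
  have hαβ := ThetaGraph.oddAlpha_mul_oddBeta hk5
  have hsin2 : Real.sin (2 * Real.pi / k) =
      2 * Real.sin (Real.pi / k) * Real.cos (Real.pi / k) := by
    rw [mul_div_assoc, Real.sin_two_mul]
  have hcos2 : Real.cos (2 * Real.pi / k) =
      Real.cos (Real.pi / k) ^ 2 - Real.sin (Real.pi / k) ^ 2 := by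
    rw [mul_div_assoc, Real.cos_two_mul']
  have hcos3 : Real.cos (Real.pi / k) + Real.cos (3 * Real.pi / k) =
      2 * Real.cos (Real.pi / k) * (Real.cos (Real.pi / k) ^ 2 - Real.sin (Real.pi / k) ^ 2) := by
    rw [mul_div_assoc, Real.cos_three_mul, Real.sin_sq]
    ring
  have hα : ThetaGraph.oddAlpha k ≠ 0 := by
    intro h
    rw [h, zero_mul] at hαβ
    have : 0 < √(ThetaGraph.unionDisc (Real.sin (Real.pi / k)) (Real.cos (Real.pi / k))) :=
      Real.sqrt_pos.2 hD
    exact absurd hαβ (by positivity)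
  have hβ2 : ThetaGraph.oddBeta k ^ 2 = 4 * Real.sin (Real.pi / k) * Real.cos (Real.pi / k) *
      (3 * Real.cos (Real.pi / k) ^ 2 - Real.sin (Real.pi / k) ^ 2) * ThetaGraph.oddGamma k := by
    rw [ThetaGraph.oddBeta_eq, Real.sq_sqrt (by positivity)]
  rw [ThetaGraph.mutualEdgeProb_eq_integral hk hk5 hN hW hW0 hWfin, Real.tan_eq_sin_div_cos,
    ThetaGraph.integral_one_div_unionArea hs hsc h1, hcos3, hsin2, hcos2, hαβ,
    Real.cot_eq_cos_div_sin]
  generalize ThetaGraph.oddAlpha k = α at *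
  generalize ThetaGraph.oddBeta k = β at *
  generalize ThetaGraph.oddGamma k = γ at *
  have hSpos : 0 < √(ThetaGraph.unionDisc (Real.sin (Real.pi / k)) (Real.cos (Real.pi / k))) :=
    Real.sqrt_pos.2 hD
  generalize √(ThetaGraph.unionDisc (Real.sin (Real.pi / k)) (Real.cos (Real.pi / k))) = S at *
  generalize Real.sin (Real.pi / k) = s at *
  generalize Real.cos (Real.pi / k) = c at *
  have e1 : 2 * (2 * c * (c ^ 2 - s ^ 2)) ^ 2 / (8 * c ^ 2 * (3 * c ^ 2 - s ^ 2) * S) =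
      (c ^ 2 - s ^ 2) ^ 2 / ((3 * c ^ 2 - s ^ 2) * S) := by
    field_simp
    ring
  have e2 : 4 * (2 * (c ^ 2 - s ^ 2) + (2 * s * c) ^ 2) / (8 * c ^ 2 * (3 * c ^ 2 - s ^ 2) * S) =
      (2 * (c ^ 2 - s ^ 2) + (2 * s * c) ^ 2) / (2 * c ^ 2 * (3 * c ^ 2 - s ^ 2) * S) := by
    field_simp
    ring
  rw [e1, e2]
  generalize Real.arctan _ + Real.arctan _ = T
  have hβ : β ≠ 0 := by
    rintro rfl
    rw [mul_zero] at hαβ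
    exact absurd hαβ (by positivity)
  -- The prefactor `2 * cot (π / k) * β / (γ * α)` is `1 / S`.
  have hpre : 2 * c * β * S = s * (γ * α) := by
    have h : (2 * c * β * S) * β * (c * (3 * c ^ 2 - s ^ 2)) =
        s * (γ * α) * β * (c * (3 * c ^ 2 - s ^ 2)) := by
      linear_combination (2 * c ^ 2 * (3 * c ^ 2 - s ^ 2) * S) * hβ2 -
        (s * γ * c * (3 * c ^ 2 - s ^ 2)) * hαβ
    exact mul_right_cancel₀ hβ (mul_right_cancel₀ (by positivity) h)
  field_simp
  linear_combination (-T) * hpre
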